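/- A \emph{unified chain graph} (UCG) $G$ over a finite node set $V$ has undirected edges $a - b$, solid directed edges $a \to b$ and dashed directed edges $a \dashrightarrow b$, at most one edge between any two nodes and no edge from a node to itself. Moreover, $G$ has no semidirected cycle (no closed walk whose first edge is $\to$ or $\dashrightarrow$ traversed forwards and whose other edges are $-$, or $\to$, $\dashrightarrow$ traversed forwards). The chain components $K \in Cc(G)$ are the maximal sets of nodes connected by undirected edges. Write $Fa(X)$, $Mo(X)$, $Ne(X)$ for the sets of nodes $b$ with $b \to a$, $b \dashrightarrow a$, $b - a$ in $G$, respectively, for some $a \in X$, and $Pa(X) = Fa(X) \cup Mo(X)$; it is required that $Fa(K) \cap Mo(K) = \emptyset$ for every $K \in Cc(G)$. A \emph{route} is a sequence of (not necessarily distinct) nodes in which consecutive nodes are adjacent in $G$; the notions below refer to occurrences of nodes in the route, and subroutes may be read in both directions. An occurrence of $C$ is a \emph{collider node} if it is the middle of a subroute $A \dashrightarrow C \dashleftarrow B$, $A \dashrightarrow C - B$ or $A \dashrightarrow C \leftarrow B$. A maximal undirected subroute $C_1 - \cdots - C_n$ ($n \ge 1$) is a \emph{collider section} if $A \to C_1 -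 \cdots - C_n \leftarrow B$ is a subroute. The route is \emph{$Z$-open} if (i) all its collider nodes are in $Z$, (ii) each of its collider sections has some node in $Z$, and (iii) every occurrence that is neither a collider node nor in a collider section is outside $Z$. For pairwise disjoint $X, Y, Z \subseteq V$, write $X \perp_G Y \mid Z$ if there is no $Z$-open route between a node in $X$ and a node in $Y$. A distribution $p$ of a random vector indexed by $V$ satisfies the \emph{global Markov property} with respect to $G$ if, for all pairwise disjoint $X, Y, Z \subseteq V$, $X \perp_G Y \mid Z$ implies that $X$ and $Y$ are conditionally independent given $Z$ under $p$. \textbf{Theorem.} Let $G$ be a UCG over $V$ and let $p$ be a Gaussian distribution on $\mathbb{R}^V$ with positive definite covariance matrix $\Sigma$. For $K \in Cc(G)$ let $$\beta_K = \Sigma_{K,Pa(K)} \Sigma_{Pa(K),Pa(K)}^{-1}, \qquad \Lambda_K = \Sigma_{K,K} - \Sigma_{K,Pa(K)} \Sigma_{Pa(K),Pa(K)}^{-1} \Sigma_{Pa(K),K},$$ which are the matrix of coefficients of the conditional mean and the covariance matrix of $p(K \mid Pa(K))$, and let $\Omega$ denote the precision matrix (inverse covariance matrix) of the marginal $p(K,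 Pa(K))$. Then $p$ satisfies $$p(V) = \prod_{K \in Cc(G)} p(K \mid Pa(K)) \qquad (1)$$ (as an identity between densities, almost everywhere) and, for every $K \in Cc(G)$, $$(\beta_K)_{i,j} = 0 \ \text{ for all } i \in K,\ j \in Mo(K) \setminus Mo(i),$$ $$\Omega_{i,j} = 0 \ \text{ for all } i \in K,\ j \in Fa(K) \setminus Fa(i),$$ $$(\Lambda_K^{-1})_{i,j} = 0 \ \text{ for all } i, j \in K \text{ with } j \ne i,\ j \notin Ne(i),$$ if and only if $p$ satisfies the global Markov property with respect to $G$. -/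

import Mathlib

open MeasureTheory ProbabilityTheory

/-- A unified chain graph (UCG) on the node set `V`: undirected edges `a - b` (`und`), solid directed
edges `a → b` (`solid a b`) and dashed directed edges `a ⇢ b` (`dashed a b`), with at most one edge
between two nodes, without semidirected cycles, and such that no node is at the same time a father
and a mother of the same chain component. -/
structure UCG (V : Type*) where
  /-- undirected edges `a - b` -/
  und : SimpleGraph V
  /-- solid directed edges `a → b` -/
  solid : V → V → Prop
  /-- dashed directed edges `a ⇢ b` -/
  dashed : V → V → Prop
  /-- At most one edge between two nodes: the remaining cases (two directed edges of opposite
  directions, or a directed and an undirected edge) are excluded by `no_semidirected_cycle`. -/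
  not_solid_and_dashed : ∀ a b, ¬ (solid a b ∧ dashed a b)
  /-- There is no cycle `a → b ⊸ ⋯ ⊸ a` or `a ⇢ b ⊸ ⋯ ⊸ a`, where `⊸` is any of `→`, `⇢`, `-`. -/
  no_semidirected_cycle : ∀ a b, (solid a b ∨ dashed a b) →
    ¬ Relation.ReflTransGen (fun c d => solid c d ∨ dashed c d ∨ und.Adj c d) b a
  /-- If `a` is a father of `b`, then it is a mother of no `c` in the chain component of `b`. -/
  fathers_disjoint_mothers : ∀ a b c, und.Reachable b c → solid a b → ¬ dashed a c

namespace UCG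

variable {V : Type*} (G : UCG V)

section Families

variable [Fintype V] [DecidableEq V]

open Classical in
/-- Fathers of a set of nodes. -/
noncomputable def Fa (X : Finset V) : Finset V := Finset.univ.filter fun b => ∃ a ∈ X, G.solid b a

open Classical in
/-- Mothers of a set of nodes. -/
noncomputable def Mo (X : Finset V) : Finset V := Finset.univ.filter fun b => ∃ a ∈ X, G.dashed b a

open Classical in
/-- Neighbours of a set of nodes. -/
noncomputable def Ne (X : Finset V) : Finset V := Finset.univ.filter fun b => ∃ a ∈ X, G.und.Adj b a

/-- Parents of a set of nodes: its fathers and its mothers. -/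
noncomputable def Pa (X : Finset V) : Finset V := G.Fa X ∪ G.Mo X

open Classical in
/-- The chain components: the maximal sets of nodes that are connected by undirected routes. -/
noncomputable def Cc : Finset (Finset V) :=
  Finset.univ.image fun v => Finset.univ.filter fun w => G.und.Reachable v w

end Families

/-- Adjacency by an edge of any type, in any direction. -/
def Adjacent (a b : V) : Prop :=
  G.solid a b ∨ G.solid b a ∨ G.dashed a b ∨ G.dashed b a ∨ G.und.Adj a b

/-- `r 0, …, r n` is a route: consecutive nodes are adjacent (nodes may be repeated; the values of
`r` beyond `n` play no role). -/
def IsRoute (n : ℕ) (r : ℕ → V) : Prop :=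
  ∀ i < n, G.Adjacent (r i) (r (i + 1))

/-- `a, c, b` is of the form `a ⇢ c ⇠ b` or `a ⇢ c - b` or `a ⇢ c ← b`. -/
def ColliderTriple (a c b : V) : Prop :=
  G.dashed a c ∧ (G.dashed b c ∨ G.und.Adj c b ∨ G.solid b c)

/-- The occurrence of a node at position `i` of the route `r 0, …, r n` is a collider node.
Subroutes may be read in both directions. -/
def IsColliderNode (n : ℕ) (r : ℕ → V) (i : ℕ) : Prop :=
  1 ≤ i ∧ i + 1 ≤ n ∧
    (G.ColliderTriple (r (i - 1)) (r i) (r (i + 1)) ∨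
      G.ColliderTriple (r (i + 1)) (r i) (r (i - 1)))

/-- Positions `j, …, k` of the route `r 0, …, r n` form a collider section
`r (j - 1) → r j - ⋯ - r k ← r (k + 1)`. Such an undirected subroute is maximal, since the route
continues by directed edges at both ends. -/
def IsColliderSection (n : ℕ) (r : ℕ → V) (j k : ℕ) : Prop :=
  1 ≤ j ∧ j ≤ k ∧ k + 1 ≤ n ∧ (∀ i, j ≤ i → i < k → G.und.Adj (r i) (r (i + 1))) ∧
    G.solid (r (j - 1)) (r j) ∧ G.solid (r (k + 1)) (r k)

/-- The route `r 0, …, r n` is `Z`-open. -/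
def IsOpen (Z : Finset V) (n : ℕ) (r : ℕ → V) : Prop :=
  (∀ i, G.IsColliderNode n r i → r i ∈ Z) ∧
  (∀ j k, G.IsColliderSection n r j k → ∃ i, j ≤ i ∧ i ≤ k ∧ r i ∈ Z) ∧
  (∀ i ≤ n, ¬ G.IsColliderNode n r i →
    (¬ ∃ j k, G.IsColliderSection n r j k ∧ j ≤ i ∧ i ≤ k) → r i ∉ Z)

/-- `X` is separated from `Y` given `Z`: there is no `Z`-open route between `X` and `Y`. -/
def Separated (X Y Z : Finset V) : Prop :=
  ¬ ∃ (n : ℕ) (r : ℕ → V), G.IsRoute n r ∧ r 0 ∈ X ∧ r n ∈ Y ∧ G.IsOpen Z n r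

end UCG

section Distribution

variable {V : Type*} [Fintype V]

/-- Under the law `p` on `V → ℝ`, the coordinates in `X` and those in `Y` are conditionally
independent given (the σ-algebra generated by) the coordinates in `Z`. -/
def CondIndepCoords (p : Measure (V → ℝ)) [IsFiniteMeasure p] (X Y Z : Finset V) : Prop :=
  CondIndepFun (MeasurableSpace.comap (Z.restrict (π := fun _ : V => ℝ)) inferInstance)
    (Finset.measurable_restrict Z).comap_le
    (X.restrict (π := fun _ : V => ℝ)) (Y.restrict (π := fun _ : V => ℝ)) p

/-- The global Markov property of `p` with respect to the UCG `G`. -/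
def GlobalMarkov (p : Measure (V → ℝ)) [IsFiniteMeasure p] (G : UCG V) : Prop :=
  ∀ X Y Z : Finset V, Disjoint X Y → Disjoint X Z → Disjoint Y Z →
    G.Separated X Y Z → CondIndepCoords p X Y Z

/-- The density of the marginal of `p` on the coordinates in `A`, evaluated at the
`A`-coordinates of `x`. -/
noncomputable def margDensity (p : Measure (V → ℝ)) (A : Finset V) (x : V → ℝ) : ENNReal :=
  (p.map (A.restrict (π := fun _ : V => ℝ))).rnDeriv volume (A.restrict x)

/-- The covariance matrix of `p`. -/
noncomputable def covMat (p : Measure (V → ℝ)) : Matrix V V ℝ :=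
  Matrix.of fun i j => cov[fun x => x i, fun x => x j; p]

/-- The block `Σ_{A,B}` of the covariance matrix of `p`. -/
noncomputable def covBlock (p : Measure (V → ℝ)) (A B : Finset V) : Matrix A B ℝ :=
  (covMat p).submatrix (fun i => (i : V)) (fun j => (j : V))

variable [DecidableEq V]

/-- The conditional density `p(A | B)`, evaluated at the corresponding coordinates of `x`. -/
noncomputable def condDensity (p : Measure (V → ℝ)) (A B : Finset V) (x : V → ℝ) : ENNReal :=
  margDensity p (A ∪ B) x / margDensity p B x

/-- The factorization `p(V) = ∏_K p(K | Pa(K))` over the chain components `K` of `G`, as an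
identity of Lebesgue densities. -/
def Factorizes (p : Measure (V → ℝ)) (G : UCG V) : Prop :=
  p.rnDeriv volume =ᵐ[volume] fun x => ∏ K ∈ G.Cc, condDensity p K (G.Pa K) x

/-- The matrix of the coefficients of the (affine) conditional mean of `K` given `P`:
`β = Σ_{K,P} Σ_{P,P}⁻¹`. -/
noncomputable def regCoef (p : Measure (V → ℝ)) (K P : Finset V) : Matrix K P ℝ :=
  covBlock p K P * (covBlock p P P)⁻¹

/-- The covariance matrix of the conditional distribution of `K` given `P`:
`Λ = Σ_{K,K} - Σ_{K,P} Σ_{P,P}⁻¹ Σ_{P,K}`. -/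
noncomputable def condCov (p : Measure (V → ℝ)) (K P : Finset V) : Matrix K K ℝ :=
  covBlock p K K - covBlock p K P * (covBlock p P P)⁻¹ * covBlock p P K

/-- The precision matrix of the marginal of `p` on the coordinates in `A`. -/
noncomputable def margPrecision (p : Measure (V → ℝ)) (A : Finset V) : Matrix A A ℝ :=
  (covBlock p A A)⁻¹

/-- `(β_K)_{i,j} = 0` for all `i ∈ K` and `j ∈ Mo(K) \ Mo(i)`. -/
def ZeroMothers (p : Measure (V → ℝ)) (G : UCG V) : Prop :=
  ∀ K ∈ G.Cc, ∀ (i : K) (j : G.Pa K), (j : V) ∈ G.Mo K \ G.Mo {(i : V)} →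
    regCoef p K (G.Pa K) i j = 0

/-- `Ω_{i,j} = 0` for all `i ∈ K` and `j ∈ Fa(K) \ Fa(i)`, where `Ω` is the precision matrix of
`p(K, Pa(K))`. -/
def ZeroFathers (p : Measure (V → ℝ)) (G : UCG V) : Prop :=
  ∀ K ∈ G.Cc, ∀ i j : (K ∪ G.Pa K : Finset V), (i : V) ∈ K →
    (j : V) ∈ G.Fa K \ G.Fa {(i : V)} → margPrecision p (K ∪ G.Pa K) i j = 0

/-- `(Λ_K⁻¹)_{i,j} = 0` for all distinct `i, j ∈ K` with `j ∉ Ne(i)`. -/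
def ZeroNeighbours (p : Measure (V → ℝ)) (G : UCG V) : Prop :=
  ∀ K ∈ G.Cc, ∀ i j : K, i ≠ j → (j : V) ∈ K \ G.Ne {(i : V)} →
    (condCov p K (G.Pa K))⁻¹ i j = 0

end Distribution

/-! ### The Lebesgue density of a nondegenerate Gaussian law -/

section GaussianDensity

open Matrix
open scoped MatrixOrder

variable {ι : Type*}

/-! Everything is reduced to linear algebra on the covariance matrix `Σ`. For a Gaussian law,
conditional independence given `Z` means that the regression residual of each coordinate of `X` on
`Z` is uncorrelated with each coordinate of `Y` (`condIndepCoords_iff`). Let `R` be the matrix whose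
row `i` holds the coefficients of the residual of `i` on the parents of its chain component, and let
`M` be block diagonal with blocks `Λ_K⁻¹`. Then the factorization says that `R Σ Rᵀ` is block
diagonal, equivalently `Σ⁻¹ = Rᵀ M R` (`factorizes_iff`, `covMat_inv_eq_iff`). Write `R = 1 - β -
F`, with `β` the coefficients of mothers and `F` those of fathers. The rows of `Ω` at `K` are those
of `M R` (`margPrecision_apply`), so the three zero conditions prescribe the zeros of `β`, of `S = M
F` and of the off-diagonal part of `M`.

From the zeros to the Markov property: let `a` be the residual vector of `x` given `Z`, and let `b =
Σ a`. Besides `b` (value), consider `(1 - β) b` (noise), `M R b` (score), `R b` (dual) and `F b`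
(mean). These satisfy a linear system whose coefficients are those of `β`, `S`, `M`, with a single
source at `(score, x)`. The equations are distributed over the unknowns, according to membership in
`Z`, so that each dependence of an equation on an unknown is a legal step of a `Z`-open route
(`FlowStep`, `FlowRoute.step`). The system is injective. It preserves the vectors supported on what
is reachable from the source, and by finite dimension its restriction to these is onto, so the
solution has this support. If `x` and `y` are separated, `(value, y)` is unreachable and `b y = 0`
(`exists_isResidual_of_separated`).

Conversely, an open route leaving a chain component with no strict descendant in `Z` can avoid
ending in a descendant only by staying in the component or by leaving it against an arrow
(`IsOpen.trichotomy`). This yields three families of separations. The corresponding independences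
say, in turn, that residuals of different components are uncorrelated, that regression coefficients
at non-mothers vanish, and that entries of `Ω` vanish. -/

theorem memLp_eval_of_isGaussian (ν : Measure (ι → ℝ)) [IsGaussian ν] (i : ι) :
    MemLp (fun x : ι → ℝ => x i) 2 ν :=
  have h : HasGaussianLaw (fun x : ι → ℝ => (fun j => x j)) ν := IsGaussian.hasGaussianLaw_id
  (h.eval (X := fun j (x : ι → ℝ) => x j) i).memLp_two

theorem covMat_transpose (ν : Measure (ι → ℝ)) : (covMat ν)ᵀ = covMat ν := by
  ext i j
  exact covariance_comm _ _

variable [Fintype ι]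

theorem covariance_dotProduct (ν : Measure (ι → ℝ)) [IsGaussian ν] (a b : ι → ℝ) :
    cov[fun x => a ⬝ᵥ x, fun x => b ⬝ᵥ x; ν] = a ⬝ᵥ covMat ν *ᵥ b := by
  simp only [dotProduct, mulVec]
  rw [covariance_fun_sum_fun_sum (fun i => (memLp_eval_of_isGaussian ν i).const_mul _)
    (fun i => (memLp_eval_of_isGaussian ν i).const_mul _)]
  refine Finset.sum_congr rfl fun i _ => ?_
  rw [Finset.mul_sum]
  refine Finset.sum_congr rfl fun j _ => ?_
  rw [covariance_const_mul_left, covariance_const_mul_right, covMat, of_apply]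
  ring

/-- The standard Gaussian distribution on `ι → ℝ` has the expected density. -/
theorem pi_gaussianReal_eq_withDensity :
    Measure.pi (fun _ : ι => gaussianReal 0 1) =
      volume.withDensity fun x => ENNReal.ofReal (∏ i, gaussianPDFReal 0 1 (x i)) := by
  refine Measure.pi_eq fun s hs => ?_
  have hint : Integrable fun x : ι → ℝ => ∏ i, gaussianPDFReal 0 1 (x i) :=
    Integrable.fintype_prod (f := fun _ => gaussianPDFReal 0 1)
      fun _ => integrable_gaussianPDFReal 0 1
  rw [withDensity_apply _ (MeasurableSet.univ_pi hs),
    ← ofReal_integral_eq_lintegral_ofReal hint.integrableOn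
      (.of_forall fun x => Finset.prod_nonneg fun i _ => gaussianPDFReal_nonneg 0 1 (x i)),
    ← integral_indicator (MeasurableSet.univ_pi hs)]
  have : (Set.univ.pi s).indicator (fun x : ι → ℝ => ∏ i, gaussianPDFReal 0 1 (x i)) =
      fun x => ∏ i, (s i).indicator (gaussianPDFReal 0 1) (x i) := by
    classical
    ext x
    simp only [Set.indicator_apply, Set.mem_univ_pi]
    split_ifs with h
    · exact Finset.prod_congr rfl fun i _ => (if_pos (h i)).symm
    · push Not at h
      obtain ⟨i, hi⟩ := h
      exact (Finset.prod_eq_zero (Finset.mem_univ i) (if_neg hi)).symm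
  rw [this, integral_fintype_prod_volume_eq_prod (fun i => (s i).indicator (gaussianPDFReal 0 1)),
    ENNReal.ofReal_prod_of_nonneg fun i _ => integral_nonneg fun x =>
      Set.indicator_nonneg (fun y _ => gaussianPDFReal_nonneg 0 1 y) x]
  refine Finset.prod_congr rfl fun i _ => ?_
  rw [integral_indicator (hs i), gaussianReal_apply_eq_integral 0 one_ne_zero]

/-- The density of the nondegenerate Gaussian distribution with mean `m` and covariance
matrix `S`. -/
noncomputable def gaussianDensity [DecidableEq ι] (m : ι → ℝ) (S : Matrix ι ι ℝ) (x : ι → ℝ) : ℝ :=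
  (√(2 * Real.pi) ^ Fintype.card ι * √S.det)⁻¹ * Real.exp (-((x - m) ⬝ᵥ S⁻¹ *ᵥ (x - m)) / 2)

variable [DecidableEq ι]

theorem continuous_gaussianDensity (m : ι → ℝ) (S : Matrix ι ι ℝ) :
    Continuous (gaussianDensity m S) := by
  unfold gaussianDensity
  simp only [dotProduct, mulVec]
  fun_prop

theorem gaussianDensity_pos (m : ι → ℝ) {S : Matrix ι ι ℝ} (hS : S.PosDef) (x : ι → ℝ) :
    0 < gaussianDensity m S x := by
  have := Real.sqrt_pos.2 hS.det_pos
  unfold gaussianDensity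
  positivity

/-- The image law is Gaussian, centred, with covariance `A Σ Aᵀ = 1`. Uncorrelated coordinates of a
Gaussian vector are independent, so the law is the product of its marginals. -/
theorem map_whitening_eq_pi (ν : Measure (ι → ℝ)) [IsGaussian ν] (A : Matrix ι ι ℝ)
    (hA : A * covMat ν * Aᵀ = 1) :
    ν.map (fun x => A *ᵥ (x - fun i => ∫ y, y i ∂ν)) =
      Measure.pi fun _ : ι => gaussianReal 0 1 := by
  set m : ι → ℝ := fun i => ∫ y, y i ∂ν
  have hlin : Measurable fun x : ι → ℝ => A *ᵥ (x - m) := by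
    have : Continuous fun x : ι → ℝ => A *ᵥ (x - m) := by fun_prop
    exact this.measurable
  have hG : HasGaussianLaw (fun x : ι → ℝ => A *ᵥ (x - m)) ν := by
    have h : HasGaussianLaw (fun x : ι → ℝ => x - m) ν :=
      ⟨inferInstanceAs (IsGaussian (ν.map fun x => x - m))⟩
    exact h.map_fun (Matrix.toLin' A).toContinuousLinearMap
  have hrow : ∀ i, (fun x : ι → ℝ => (A *ᵥ (x - m)) i) = fun x => A i ⬝ᵥ x - A i ⬝ᵥ m := fun i => by
    ext x
    rw [mulVec, dotProduct_sub]
  have hdotL : ∀ a : ι → ℝ, MemLp (fun x => a ⬝ᵥ x) 2 ν := fun a =>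
    memLp_finsetSum _ fun i _ => (memLp_eval_of_isGaussian ν i).const_mul (a i)
  have hdot : ∀ a : ι → ℝ, Integrable (fun x => a ⬝ᵥ x) ν := fun a =>
    (hdotL a).integrable one_le_two
  have hcov : ∀ i j, cov[fun x : ι → ℝ => (A *ᵥ (x - m)) i, fun x => (A *ᵥ (x - m)) j; ν] =
      (1 : Matrix ι ι ℝ) i j := fun i j => by
    rw [hrow, hrow, covariance_sub_const_left (hdot _), covariance_sub_const_right (hdot _),
      covariance_dotProduct, ← hA]
    simp [Matrix.mul_apply, dotProduct, mulVec, Finset.sum_mul, Finset.mul_sum, mul_assoc]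
    rw [Finset.sum_comm]
  have hind : iIndepFun (fun i (x : ι → ℝ) => (A *ᵥ (x - m)) i) ν :=
    HasGaussianLaw.iIndepFun_of_covariance_eq_zero hG fun i j hij => by
      rw [hcov, one_apply_ne hij]
  have hmean : ∀ i, ∫ x, (A *ᵥ (x - m)) i ∂ν = 0 := fun i => by
    rw [hrow, integral_sub (hdot _) (integrable_const _), integral_const]
    simp only [dotProduct]
    rw [integral_finsetSum _ fun j _ =>
      ((memLp_eval_of_isGaussian ν j).integrable one_le_two).const_mul _]
    simp [integral_const_mul, m]
  rw [(iIndepFun_iff_map_fun_eq_pi_map fun i => (hG.eval i).aemeasurable).1 hind]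
  congr 1
  ext1 i
  rw [(hG.eval i).map_eq_gaussianReal, hmean, ← covariance_self (hG.eval i).aemeasurable, hcov]
  simp

/-- Factor `Σ⁻¹ = Aᵀ A`. The map `x ↦ A (x - m)` whitens `ν`, and the density of the standard
Gaussian is pulled back along it, with Jacobian `|det A| = (√det Σ)⁻¹`. -/
theorem isGaussian_eq_withDensity (ν : Measure (ι → ℝ)) [IsGaussian ν]
    (hν : (covMat ν).PosDef) :
    ν = volume.withDensity fun x =>
      ENNReal.ofReal (gaussianDensity (fun i => ∫ y, y i ∂ν) (covMat ν) x) := by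
  set S := covMat ν with hS
  set m : ι → ℝ := fun i => ∫ y, y i ∂ν with hm
  obtain ⟨A, hA⟩ : ∃ A : Matrix ι ι ℝ, S⁻¹ = Aᵀ * A := by
    obtain ⟨A, hA⟩ := CStarAlgebra.nonneg_iff_eq_star_mul_self.1 hν.inv.posSemidef.nonneg
    exact ⟨A, hA⟩
  have hdetS : 0 < S.det := hν.det_pos
  have hdet : S.det⁻¹ = A.det ^ 2 := by
    rw [← Ring.inverse_eq_inv', ← det_nonsing_inv, hA, det_mul, det_transpose, sq]
  have hA0 : A.det ≠ 0 := fun h => by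
    rw [h] at hdet
    simp [hdetS.ne'] at hdet
  have hAu : IsUnit A.det := hA0.isUnit
  have hSu : IsUnit S.det := hdetS.ne'.isUnit
  have hAS : A * S * Aᵀ = 1 := by
    have h1 : Aᵀ * (A * S) = 1 := by rw [← Matrix.mul_assoc, ← hA, nonsing_inv_mul _ hSu]
    exact mul_eq_one_comm.1 h1
  have hmap := map_whitening_eq_pi ν A hAS
  rw [← hm, pi_gaussianReal_eq_withDensity] at hmap
  set T : (ι → ℝ) → ι → ℝ := fun x => A *ᵥ (x - m) with hT
  have hTm : Measurable T := by
    have : Continuous T := by fun_prop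
    exact this.measurable
  set R : (ι → ℝ) → ι → ℝ := fun z => A⁻¹ *ᵥ z + m with hR
  have hRm : Measurable R := by
    have : Continuous R := by fun_prop
    exact this.measurable
  have hRT : ∀ x, R (T x) = x := fun x => by
    simp [hR, hT, mulVec_mulVec, nonsing_inv_mul _ hAu]
  have hvol : (volume : Measure (ι → ℝ)).map T = ENNReal.ofReal |A.det⁻¹| • volume := by
    rw [← Real.map_matrix_volume_pi_eq_smul_volume_pi hA0]
    have : T = Matrix.toLin' A ∘ fun x => x - m := by
      ext x
      simp [hT]
    rw [this, ← Measure.map_map _ (by fun_prop)]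
    · rw [(measurePreserving_sub_right volume m).map_eq]
    · exact (LinearMap.continuous_of_finiteDimensional _).measurable
  have hvol' : (volume : Measure (ι → ℝ)) = ENNReal.ofReal |A.det| • volume.map T := by
    rw [hvol, smul_smul, ← ENNReal.ofReal_mul (abs_nonneg _), ← abs_mul, mul_inv_cancel₀ hA0]
    simp
  have hg : Measurable fun z : ι → ℝ => ENNReal.ofReal (∏ i, gaussianPDFReal 0 1 (z i)) := by
    refine ENNReal.measurable_ofReal.comp (Finset.measurable_prod _ fun i _ => ?_)
    exact (measurable_gaussianPDFReal 0 1).comp (measurable_pi_apply i)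
  ext s hs
  have hs' : MeasurableSet (R ⁻¹' s) := hRm hs
  have hpre : T ⁻¹' (R ⁻¹' s) = s := by
    ext x
    simp [hRT]
  have h1 : ν s = ν.map T (R ⁻¹' s) := by rw [Measure.map_apply hTm hs', hpre]
  have hgT : Measurable fun x => ENNReal.ofReal (∏ i, gaussianPDFReal 0 1 (T x i)) := hg.comp hTm
  rw [h1, hmap, withDensity_apply _ hs', withDensity_apply _ hs, hvol',
    Measure.restrict_smul, lintegral_smul_measure, setLIntegral_map hs' hg hTm, hpre, ← hvol',
    smul_eq_mul, ← lintegral_const_mul _ hgT]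
  refine lintegral_congr fun x => ?_
  rw [← ENNReal.ofReal_mul (abs_nonneg _)]
  congr 1
  have hdens : ∏ i, gaussianPDFReal 0 1 (T x i) =
      (√(2 * Real.pi) ^ Fintype.card ι)⁻¹ * Real.exp (-(T x ⬝ᵥ T x) / 2) := by
    simp only [gaussianPDFReal, Finset.prod_mul_distrib, ← Real.exp_sum]
    simp [dotProduct, Finset.sum_div, sq, Finset.sum_neg_distrib, neg_div, mul_pow, mul_comm]
  have hquad : T x ⬝ᵥ T x = (x - m) ⬝ᵥ S⁻¹ *ᵥ (x - m) := by
    rw [hA, hT, ← mulVec_mulVec, dotProduct_mulVec (x - m) Aᵀ, vecMul_transpose]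
  have habs : |A.det| = (√S.det)⁻¹ := by
    rw [← Real.sqrt_inv, hdet, Real.sqrt_sq_eq_abs]
  rw [hdens, hquad, habs, gaussianDensity, mul_inv]
  ring

end GaussianDensity

/-! ### Conditional independence through residuals, for general random variables -/

section CondIndep

variable {Ω β δ ι : Type*} [MeasurableSpace Ω] [MeasurableSpace β] [MeasurableSpace δ]
  [Fintype ι] {μ : Measure Ω} [IsProbabilityMeasure μ]

/-- The kernel that sends `v` to the translate of the measure `ρ` by `ψ v`. -/
noncomputable def translationKernel (ψ : δ → ι → ℝ) (ρ : Measure (ι → ℝ)) : Kernel δ (ι → ℝ) :=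
  (Kernel.id ×ₖ Kernel.const δ ρ).map fun p => ψ p.1 + p.2

instance (ψ : δ → ι → ℝ) (ρ : Measure (ι → ℝ)) [IsFiniteMeasure ρ] :
    IsFiniteKernel (translationKernel ψ ρ) := by
  unfold translationKernel
  infer_instance

theorem translationKernel_apply {ψ : δ → ι → ℝ} (hψ : Measurable ψ) (ρ : Measure (ι → ℝ))
    [IsFiniteMeasure ρ] (v : δ) : translationKernel ψ ρ v = ρ.map fun u => ψ v + u := by
  have hm : Measurable fun p : δ × (ι → ℝ) => ψ p.1 + p.2 := by fun_prop
  rw [translationKernel, Kernel.map_apply _ hm, Kernel.prod_apply, Kernel.id_apply,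
    Kernel.const_apply, Measure.dirac_prod, Measure.map_map hm (by fun_prop)]
  rfl

theorem compProd_translationKernel {ψ : δ → ι → ℝ} (hψ : Measurable ψ) (ν : Measure δ)
    [IsFiniteMeasure ν] (ρ : Measure (ι → ℝ)) [IsFiniteMeasure ρ] :
    ν ⊗ₘ translationKernel ψ ρ = (ν.prod ρ).map fun p => (p.1, ψ p.1 + p.2) := by
  ext s hs
  have hm : Measurable fun p : δ × (ι → ℝ) => (p.1, ψ p.1 + p.2) := by fun_prop
  rw [Measure.compProd_apply hs, Measure.map_apply hm hs, Measure.prod_apply (hm hs)]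
  refine lintegral_congr fun v => ?_
  rw [translationKernel_apply hψ, Measure.map_apply (by fun_prop) (measurable_prodMk_left hs)]
  rfl

/-- The shear `(v, u) ↦ (v, ψ v + u)` is invertible. It carries the joint law of `V` and the
residual to that of `V` and `f`, and the product law to the composition with the translation kernel.
-/
theorem condDistrib_ae_eq_translationKernel_iff {V : Ω → δ} (hV : Measurable V) {f : Ω → ι → ℝ}
    (hf : Measurable f) {ψ : δ → ι → ℝ} (hψ : Measurable ψ) :
    condDistrib f V μ =ᵐ[μ.map V] translationKernel ψ (μ.map fun ω => f ω - ψ (V ω)) ↔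
      IndepFun V (fun ω => f ω - ψ (V ω)) μ := by
  have hU : Measurable fun ω => f ω - ψ (V ω) := by fun_prop
  have hm : Measurable fun p : δ × (ι → ℝ) => (p.1, ψ p.1 + p.2) := by fun_prop
  have hm' : Measurable fun p : δ × (ι → ℝ) => (p.1, p.2 - ψ p.1) := by fun_prop
  rw [condDistrib_ae_eq_iff_measure_eq_compProd _ hf.aemeasurable,
    compProd_translationKernel hψ,
    indepFun_iff_map_prod_eq_prod_map_map hV.aemeasurable hU.aemeasurable]
  constructor
  · intro h
    have := congrArg (Measure.map fun p : δ × (ι → ℝ) => (p.1, p.2 - ψ p.1)) h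
    rw [Measure.map_map hm' (by fun_prop), Measure.map_map hm' hm] at this
    simpa [Function.comp_def] using this
  · intro h
    rw [← h, Measure.map_map hm (by fun_prop)]
    simp [Function.comp_def]

/-- If `f - φ ∘ k` is independent of `k`, then `g` and `f` are conditionally independent given `k`
if and only if `f - φ ∘ k` is independent of `(k, g)`. -/
theorem condIndepFun_iff_indepFun_sub [StandardBorelSpace Ω] [StandardBorelSpace β] [Nonempty β]
    {k : Ω → δ} (hk : Measurable k) {f : Ω → ι → ℝ} (hf : Measurable f) {g : Ω → β}
    (hg : Measurable g) {φ : δ → ι → ℝ} (hφ : Measurable φ)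
    (h : IndepFun k (fun ω => f ω - φ (k ω)) μ) :
    g ⟂ᵢ[k, hk; μ] f ↔ IndepFun (fun ω => (k ω, g ω)) (fun ω => f ω - φ (k ω)) μ := by
  have hkg : Measurable fun ω => (k ω, g ω) := hk.prodMk hg
  have h1 := (condDistrib_ae_eq_translationKernel_iff hk hf hφ).2 h
  have h2 := condDistrib_ae_eq_translationKernel_iff (μ := μ) (V := fun ω => (k ω, g ω)) hkg hf
    (ψ := fun p => φ p.1) (by fun_prop)
  rw [condIndepFun_iff_condDistrib_prod_ae_eq_prodMkRight hf hg hk, ← h2]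
  have h3 : (condDistrib f k μ).prodMkRight β =ᵐ[μ.map fun ω => (k ω, g ω)]
      translationKernel (fun p : δ × β => φ p.1) (μ.map fun ω => f ω - φ (k ω)) := by
    have hq : Measure.QuasiMeasurePreserving Prod.fst (μ.map fun ω => (k ω, g ω)) (μ.map k) := by
      refine ⟨measurable_fst, ?_⟩
      rw [Measure.map_map measurable_fst hkg]
      exact Measure.AbsolutelyContinuous.rfl
    have hq' := hq.ae h1
    have hU : Measurable fun ω => f ω - φ (k ω) := by fun_prop
    have : IsProbabilityMeasure (μ.map fun ω => f ω - φ (k ω)) :=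
      Measure.isProbabilityMeasure_map hU.aemeasurable
    filter_upwards [hq'] with p hp
    rw [Kernel.prodMkRight_apply, hp, translationKernel_apply hφ,
      translationKernel_apply (by fun_prop)]
  exact ⟨fun h => h.trans h3, fun h => h.trans h3.symm⟩

end CondIndep

/-! ### Residual vectors of linear regressions -/

section Residual

open Matrix

variable {V : Type*} [Fintype V]

/-- `a` is the vector of coefficients of the residual of the linear regression of the `i`-th
coordinate on the coordinates in `Z`, when `S` is the covariance matrix. -/
structure IsResidual (S : Matrix V V ℝ) (Z : Finset V) (i : V) (a : V → ℝ) : Prop where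
  apply_self : a i = 1
  apply_eq_zero : ∀ v, v ≠ i → v ∉ Z → a v = 0
  mulVec_eq_zero : ∀ z ∈ Z, (S *ᵥ a) z = 0

/-- Each summand of `a ⬝ᵥ S *ᵥ a` has a vanishing factor. Uniqueness of residuals and injectivity of
the flow system both rest on this. -/
theorem Matrix.PosDef.eq_zero_of_mulVec_eq_zero_on {S : Matrix V V ℝ} (hS : S.PosDef)
    {A : Set V} {a : V → ℝ} (h0 : ∀ v ∉ A, a v = 0) (h1 : ∀ v ∈ A, (S *ᵥ a) v = 0) : a = 0 := by
  by_contra ha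
  have := hS.dotProduct_mulVec_pos ha
  refine this.ne' (Finset.sum_eq_zero fun v _ => ?_)
  by_cases hv : v ∈ A
  · rw [h1 v hv, mul_zero]
  · simp [h0 v hv]

theorem IsResidual.eq {S : Matrix V V ℝ} (hS : S.PosDef) {Z : Finset V} {i : V} {a b : V → ℝ}
    (ha : IsResidual S Z i a) (hb : IsResidual S Z i b) : a = b := by
  rw [← sub_eq_zero]
  refine hS.eq_zero_of_mulVec_eq_zero_on (A := Z) (fun v hv => ?_) fun z hz => ?_
  · by_cases h : v = i
    · rw [h, Pi.sub_apply, ha.apply_self, hb.apply_self, sub_self]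
    · rw [Pi.sub_apply, ha.apply_eq_zero v h hv, hb.apply_eq_zero v h hv, sub_self]
  · rw [mulVec_sub, Pi.sub_apply, ha.mulVec_eq_zero z hz, hb.mulVec_eq_zero z hz, sub_self]

variable [DecidableEq V]

theorem sum_eq_add_sum_of_support {Z : Finset V} {i : V} (hi : i ∉ Z) {f : V → ℝ}
    (h : ∀ v, v ≠ i → v ∉ Z → f v = 0) : ∑ v, f v = f i + ∑ z : Z, f z := by
  rw [Finset.sum_coe_sort Z f, ← Finset.sum_insert hi]
  refine (Finset.sum_subset (Finset.subset_univ _) fun v _ hv => ?_).symm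
  rw [Finset.mem_insert, not_or] at hv
  exact h v hv.1 hv.2

theorem exists_isResidual {S : Matrix V V ℝ} (hS : S.PosDef) {Z : Finset V} {i : V} (hi : i ∉ Z) :
    ∃ a, IsResidual S Z i a := by
  set R : Matrix Z Z ℝ := S.submatrix (fun z => (z : V)) fun z => (z : V) with hR
  have hRu : IsUnit R.det := (hS.submatrix Subtype.val_injective).det_pos.ne'.isUnit
  -- The normal equations: `c` is the vector of regression coefficients of the coordinate `i` on
  -- `Z`.
  set c : Z → ℝ := R⁻¹ *ᵥ fun z => S z i with hc
  have hRc : R *ᵥ c = fun z : Z => S z i := by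
    rw [hc, mulVec_mulVec, mul_nonsing_inv _ hRu, one_mulVec]
  set a : V → ℝ := fun v => if v = i then 1 else if h : v ∈ Z then -c ⟨v, h⟩ else 0 with ha
  have haz : ∀ z : Z, a z = -c z := fun z => by
    have : (z : V) ≠ i := fun h => hi (h ▸ z.2)
    simp [ha, this]
  refine ⟨a, by simp [ha], fun v h1 h2 => by simp [ha, h1, h2], fun z hz => ?_⟩
  rw [mulVec, dotProduct, sum_eq_add_sum_of_support hi fun v h1 h2 => by simp [ha, h1, h2]]
  have := congrFun hRc ⟨z, hz⟩
  simp only [mulVec, dotProduct, hR, submatrix_apply] at this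
  simp only [haz, mul_neg, Finset.sum_neg_distrib, this]
  simp [ha]

/-- Orthogonality of the residual to `P` says that the row `-a` restricted to `P` solves `β Σ_{P,P}
= Σ_{K,P}` in row `i`. -/
theorem IsResidual.regCoef_eq {p : Measure (V → ℝ)} (hp : (covMat p).PosDef) {K P : Finset V}
    (i : K) (j : P) {a : V → ℝ} (ha : IsResidual (covMat p) P i a) (hi : (i : V) ∉ P) :
    regCoef p K P i j = -a j := by
  have hu : IsUnit (covBlock p P P).det :=
    (hp.submatrix Subtype.val_injective).det_pos.ne'.isUnit
  have h1 : (fun z : P => -a z) ᵥ* covBlock p P P = covBlock p K P i := by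
    ext z
    have := ha.mulVec_eq_zero z z.2
    rw [mulVec, dotProduct, sum_eq_add_sum_of_support hi fun v h1 h2 => by
      simp [ha.apply_eq_zero v h1 h2], ha.apply_self] at this
    have hsymm : ∀ v w, covMat p v w = covMat p w v := fun v w => covariance_comm _ _
    simp only [vecMul, dotProduct, covBlock, submatrix_apply, neg_mul, Finset.sum_neg_distrib]
    simp only [hsymm _ (z : V), mul_comm (a _)]
    linarith
  have h2 : regCoef p K P i = covBlock p K P i ᵥ* (covBlock p P P)⁻¹ := rfl
  rw [h2, ← h1, vecMul_vecMul, mul_nonsing_inv _ hu, vecMul_one]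

end Residual

/-! ### Conditional independence of Gaussian coordinates -/

section CondIndepCoords

open Matrix

variable {V : Type*} [Fintype V] {p : Measure (V → ℝ)} [IsGaussian p]

theorem covariance_eval_dotProduct (a : V → ℝ) (i : V) :
    cov[fun x => x i, fun x => a ⬝ᵥ x; p] = (covMat p *ᵥ a) i := by
  classical
  simpa using covariance_dotProduct p (Pi.single i 1) a

theorem indepFun_restrict_dotProduct_iff {ι : Type*} [Fintype ι] (a : ι → V → ℝ) (W : Finset V) :
    IndepFun (W.restrict (π := fun _ : V => ℝ)) (fun x i => a i ⬝ᵥ x) p ↔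
      ∀ i, ∀ w ∈ W, (covMat p *ᵥ a i) w = 0 := by
  constructor
  · intro h i w hw
    have h' : IndepFun (fun x : V → ℝ => x w) (fun x => a i ⬝ᵥ x) p :=
      h.comp (φ := fun y : W → ℝ => y ⟨w, hw⟩) (ψ := fun y : ι → ℝ => y i)
        (measurable_pi_apply _) (measurable_pi_apply _)
    rw [← covariance_eval_dotProduct]
    have hL : MemLp (fun x => a i ⬝ᵥ x) 2 p :=
      memLp_finsetSum _ fun v _ => (memLp_eval_of_isGaussian p v).const_mul (a i v)
    exact h'.covariance_eq_zero (memLp_eval_of_isGaussian p w) hL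
  · intro h
    let L : (V → ℝ) →ₗ[ℝ] (W → ℝ) × (ι → ℝ) :=
      { toFun := fun x => (fun w => x w, fun i => a i ⬝ᵥ x)
        map_add' := fun x y => by
          ext <;> simp [dotProduct_add]
        map_smul' := fun c x => by
          ext <;> simp }
    have hG : HasGaussianLaw (fun x : V → ℝ => (fun w : W => x w, fun i => a i ⬝ᵥ x)) p :=
      (IsGaussian.hasGaussianLaw_id (μ := p)).map_fun L.toContinuousLinearMap
    refine HasGaussianLaw.indepFun_of_covariance_eval (X := fun (w : W) (x : V → ℝ) => x w)
      (Y := fun i (x : V → ℝ) => a i ⬝ᵥ x) hG fun w i => ?_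
    rw [covariance_eval_dotProduct]
    exact h i w w.2

variable [DecidableEq V]

/-- For a nondegenerate Gaussian distribution, conditional independence of coordinates means that
the residuals of the first coordinates are uncorrelated with the second coordinates. -/
theorem condIndepCoords_iff (hp : (covMat p).PosDef) {X Y Z : Finset V} (hXZ : Disjoint X Z) :
    CondIndepCoords p X Y Z ↔
      ∀ i ∈ X, ∀ j ∈ Y, ∃ a, IsResidual (covMat p) Z i a ∧ (covMat p *ᵥ a) j = 0 := by
  have hX : ∀ i : X, (i : V) ∉ Z := fun i => Finset.disjoint_left.1 hXZ i.2
  choose a ha using fun i : X => exists_isResidual hp (hX i)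
  -- The sign makes `φ` the linear predictor of the coordinates in `X`, so that subtracting it
  -- leaves the combinations `a i ⬝ᵥ x`.
  set φ : (Z → ℝ) → X → ℝ := fun z i => -∑ w : Z, a i w * z w with hφ
  have hφm : Measurable φ := by
    have : Continuous φ := by fun_prop
    exact this.measurable
  have hU : (fun x : V → ℝ => X.restrict (π := fun _ : V => ℝ) x -
      φ (Z.restrict (π := fun _ : V => ℝ) x)) = fun x i => a i ⬝ᵥ x := by
    ext x i
    rw [dotProduct, sum_eq_add_sum_of_support (hX i) fun v h1 h2 => by
      simp [(ha i).apply_eq_zero v h1 h2], (ha i).apply_self]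
    simp [hφ]
  have hZ := Finset.measurable_restrict (X := fun _ : V => ℝ) Z
  have hkey := condIndepFun_iff_indepFun_sub (μ := p) hZ
    (Finset.measurable_restrict (X := fun _ : V => ℝ) X)
    (Finset.measurable_restrict (X := fun _ : V => ℝ) Y) hφm
    (by
      rw [hU]
      exact (indepFun_restrict_dotProduct_iff a Z).2 fun i => (ha i).mulVec_eq_zero)
  rw [hU] at hkey
  have hcomm : CondIndepCoords p X Y Z ↔
      (Y.restrict (π := fun _ : V => ℝ)) ⟂ᵢ[Z.restrict (π := fun _ : V => ℝ), hZ; p]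
        (X.restrict (π := fun _ : V => ℝ)) :=
    ⟨fun h => CondIndepFun.symm h, fun h => CondIndepFun.symm h⟩
  rw [hcomm, hkey]
  constructor
  · intro h i hi j hj
    refine ⟨a ⟨i, hi⟩, ha ⟨i, hi⟩, ?_⟩
    have h' : IndepFun (Y.restrict (π := fun _ : V => ℝ)) (fun x i => a i ⬝ᵥ x) p :=
      h.comp (φ := Prod.snd) (ψ := id) measurable_snd measurable_id
    exact (indepFun_restrict_dotProduct_iff a Y).1 h' ⟨i, hi⟩ j hj
  · intro h
    have h1 : IndepFun ((Z ∪ Y).restrict (π := fun _ : V => ℝ)) (fun x i => a i ⬝ᵥ x) p := by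
      refine (indepFun_restrict_dotProduct_iff a (Z ∪ Y)).2 fun i w hw => ?_
      rcases Finset.mem_union.1 hw with hw | hw
      · exact (ha i).mulVec_eq_zero w hw
      · obtain ⟨b, hb, hb0⟩ := h i i.2 w hw
        rwa [(ha i).eq hp hb]
    exact h1.comp (φ := fun y : (Z ∪ Y : Finset V) → ℝ =>
      (fun z : Z => y ⟨z, Finset.mem_union_left _ z.2⟩,
        fun z : Y => y ⟨z, Finset.mem_union_right _ z.2⟩)) (ψ := id) (by fun_prop) measurable_id

end CondIndepCoords

/-! ### Extending open routes by one edge -/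

namespace UCG

variable {V : Type*} {G : UCG V}

theorem not_solid_of_solid {a b : V} (h : G.solid a b) : ¬ G.solid b a := fun h' =>
  G.no_semidirected_cycle a b (.inl h) (.single (.inl h'))

theorem not_dashed_of_solid {a b : V} (h : G.solid a b) : ¬ G.dashed a b := fun h' =>
  G.not_solid_and_dashed a b ⟨h, h'⟩

theorem not_dashed_symm_of_solid {a b : V} (h : G.solid a b) : ¬ G.dashed b a := fun h' =>
  G.no_semidirected_cycle a b (.inl h) (.single (.inr (.inl h')))

theorem not_dashed_of_dashed {a b : V} (h : G.dashed a b) : ¬ G.dashed b a := fun h' =>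
  G.no_semidirected_cycle a b (.inr h) (.single (.inr (.inl h')))

theorem not_solid_of_und {a b : V} (h : G.und.Adj a b) : ¬ G.solid a b := fun h' =>
  G.no_semidirected_cycle a b (.inl h') (.single (.inr (.inr h.symm)))

theorem not_dashed_of_und {a b : V} (h : G.und.Adj a b) : ¬ G.dashed a b := fun h' =>
  G.no_semidirected_cycle a b (.inr h') (.single (.inr (.inr h.symm)))

/-- The way in which a route enters a maximal undirected subroute: the route starts there or
traverses an arrow backwards, or it traverses a dashed arrow, or it traverses a solid arrow. -/
inductive Entry
  | tail
  | dashed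
  | solid

/-- The route `r` enters position `s` in the given way. -/
def EntryAt (G : UCG V) (r : ℕ → V) (s : ℕ) : Entry → Prop
  | .tail => s = 0 ∨ 1 ≤ s ∧ (G.solid (r s) (r (s - 1)) ∨ G.dashed (r s) (r (s - 1)))
  | .dashed => 1 ≤ s ∧ G.dashed (r (s - 1)) (r s)
  | .solid => 1 ≤ s ∧ G.solid (r (s - 1)) (r s)

/-- The positions of the route before `t` satisfy the requirements for being `Z`-open. -/
structure OpenBefore (G : UCG V) (Z : Finset V) (n : ℕ) (r : ℕ → V) (t : ℕ) : Prop where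
  node : ∀ i < t, G.IsColliderNode n r i → r i ∈ Z
  sect : ∀ j k, k < t → G.IsColliderSection n r j k → ∃ i, j ≤ i ∧ i ≤ k ∧ r i ∈ Z
  other : ∀ i < t, ¬ G.IsColliderNode n r i →
    (¬ ∃ j k, G.IsColliderSection n r j k ∧ j ≤ i ∧ i ≤ k) → r i ∉ Z

/-- The route starts in `X`, ends with the undirected subroute at the positions `s, …, n`, which is
entered as described by `e`, and is `Z`-open before `s`. -/
structure EndsWithSection (G : UCG V) (X Z : Finset V) (n : ℕ) (r : ℕ → V) (s : ℕ) (e : Entry) :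
    Prop where
  route : G.IsRoute n r
  start : r 0 ∈ X
  le : s ≤ n
  und : ∀ i, s ≤ i → i < n → G.und.Adj (r i) (r (i + 1))
  before : G.OpenBefore Z n r s
  entry : G.EntryAt r s e

theorem isColliderNode_congr {n : ℕ} {r r' : ℕ → V} (hr : ∀ i ≤ n, r' i = r i) {i : ℕ}
    (hi : i < n) : G.IsColliderNode (n + 1) r' i ↔ G.IsColliderNode n r i := by
  unfold IsColliderNode
  rw [hr i hi.le, hr (i + 1) hi, hr (i - 1) (by omega)]
  constructor <;> rintro ⟨h1, h2, h3⟩ <;> exact ⟨h1, by omega, h3⟩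

theorem isColliderSection_congr {n : ℕ} {r r' : ℕ → V} (hr : ∀ i ≤ n, r' i = r i) {j k : ℕ}
    (hk : k < n) : G.IsColliderSection (n + 1) r' j k ↔ G.IsColliderSection n r j k := by
  constructor
  · rintro ⟨h1, h2, h3, h4, h5, h6⟩
    refine ⟨h1, h2, by omega, fun i hi hi' => ?_, ?_, ?_⟩
    · rw [← hr i (by omega), ← hr (i + 1) (by omega)]
      exact h4 i hi hi'
    · rwa [← hr (j - 1) (by omega), ← hr j (by omega)]
    · rwa [← hr (k + 1) (by omega), ← hr k (by omega)]
  · rintro ⟨h1, h2, h3, h4, h5, h6⟩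
    refine ⟨h1, h2, by omega, fun i hi hi' => ?_, ?_, ?_⟩
    · rw [hr i (by omega), hr (i + 1) (by omega)]
      exact h4 i hi hi'
    · rwa [hr (j - 1) (by omega), hr j (by omega)]
    · rwa [hr (k + 1) (by omega), hr k (by omega)]

theorem OpenBefore.extend {Z : Finset V} {n t : ℕ} {r r' : ℕ → V} (h : G.OpenBefore Z n r t)
    (hr : ∀ i ≤ n, r' i = r i) (ht : t ≤ n) : G.OpenBefore Z (n + 1) r' t where
  node i hi hc := by
    rw [hr i (by omega)]
    exact h.node i hi ((isColliderNode_congr hr (by omega)).1 hc)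
  sect j k hk hs := by
    obtain ⟨i, h1, h2, h3⟩ := h.sect j k hk ((isColliderSection_congr hr (by omega)).1 hs)
    exact ⟨i, h1, h2, by rwa [hr i (by omega)]⟩
  other i hi hc hs := by
    rw [hr i (by omega)]
    refine h.other i hi (fun hc' => hc ((isColliderNode_congr hr (by omega)).2 hc')) ?_
    rintro ⟨j, k, hjk, h1, h2⟩
    exact hs ⟨j, k, (isColliderSection_congr hr hjk.2.2.1).2 hjk, h1, h2⟩

theorem EntryAt.congr {r r' : ℕ → V} {s : ℕ} {e : Entry} (h : G.EntryAt r s e)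
    (hr : ∀ i ≤ s, r' i = r i) : G.EntryAt r' s e := by
  cases e <;> simpa only [EntryAt, hr s le_rfl, hr (s - 1) (Nat.sub_le s 1)] using h

theorem IsRoute.extend {n : ℕ} {r r' : ℕ → V} (h : G.IsRoute n r) (hr : ∀ i ≤ n, r' i = r i)
    (ha : G.Adjacent (r n) (r' (n + 1))) : G.IsRoute (n + 1) r' := by
  intro i hi
  rcases Nat.lt_succ_iff_lt_or_eq.1 hi with hi | rfl
  · rw [hr i hi.le, hr (i + 1) hi]
    exact h i hi
  · rwa [hr i le_rfl]

/-- The route `r 0, …, r n, v`. -/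
def snoc (n : ℕ) (r : ℕ → V) (v : V) (i : ℕ) : V := if i ≤ n then r i else v

theorem snoc_of_le {n : ℕ} {r : ℕ → V} {v : V} : ∀ i ≤ n, snoc n r v i = r i :=
  fun _ hi => if_pos hi

theorem snoc_succ {n : ℕ} {r : ℕ → V} {v : V} : snoc n r v (n + 1) = v := if_neg (by omega)

namespace EndsWithSection

variable {X Z : Finset V} {n s : ℕ} {r r' : ℕ → V} {e : Entry}

theorem extend_und (h : G.EndsWithSection X Z n r s e) (hr : ∀ i ≤ n, r' i = r i)
    (hv : G.und.Adj (r n) (r' (n + 1))) : G.EndsWithSection X Z (n + 1) r' s e where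
  route := h.route.extend hr (.inr (.inr (.inr (.inr hv))))
  start := by rw [hr 0 (by omega)]; exact h.start
  le := h.le.trans n.le_succ
  und i hi hi' := by
    rcases Nat.lt_succ_iff_lt_or_eq.1 hi' with hi' | rfl
    · rw [hr i hi'.le, hr (i + 1) hi']
      exact h.und i hi hi'
    · rwa [hr i le_rfl]
  before := h.before.extend hr h.le
  entry := h.entry.congr fun i hi => hr i (hi.trans h.le)

/-- A collider section that ends in the last undirected subroute is this subroute. -/
theorem eq_of_isColliderSection (h : G.EndsWithSection X Z n r s e) (hr : ∀ i ≤ n, r' i = r i)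
    {j k : ℕ} (hjk : G.IsColliderSection (n + 1) r' j k) (hk : s ≤ k) :
    j = s ∧ k = n ∧ e = .solid ∧ G.solid (r' (n + 1)) (r n) := by
  obtain ⟨h1, h2, h3, h4, h5, h6⟩ := hjk
  have hle := h.le
  have hkn : k = n := by
    by_contra hkn
    have hkn : k < n := by omega
    rw [hr (k + 1) hkn, hr k hkn.le] at h6
    exact not_solid_of_und (h.und k hk hkn).symm h6
  subst hkn
  have hjs : j = s := by
    rcases lt_trichotomy j s with hjs | hjs | hjs
    · have hu := h4 (s - 1) (by omega) (by omega)
      rw [Nat.sub_add_cancel (by omega), hr (s - 1) (by omega), hr s hle] at hu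
      have he := h.entry
      cases e with
      | tail =>
        rcases he with he | ⟨-, he | he⟩
        · omega
        · exact absurd he (not_solid_of_und hu.symm)
        · exact absurd he (not_dashed_of_und hu.symm)
      | dashed => exact absurd he.2 (not_dashed_of_und hu)
      | solid => exact absurd he.2 (not_solid_of_und hu)
    · exact hjs
    · have hu := h.und (j - 1) (by omega) (by omega)
      rw [Nat.sub_add_cancel (by omega)] at hu
      rw [hr (j - 1) (by omega), hr j (by omega)] at h5
      exact absurd h5 (not_solid_of_und hu)
  subst hjs
  rw [hr k le_rfl] at h6
  rw [hr (j - 1) (by omega), hr j (by omega)] at h5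
  refine ⟨rfl, rfl, ?_, h6⟩
  have he := h.entry
  cases e with
  | tail =>
    rcases he with he | ⟨-, he | he⟩
    · omega
    · exact absurd he (not_solid_of_solid h5)
    · exact absurd he (not_dashed_symm_of_solid h5)
  | dashed => exact absurd he.2 (not_dashed_of_solid h5)
  | solid => rfl

/-- In the interior of the last undirected subroute, only its first node can be a collider node. -/
theorem isColliderNode_iff_of_lt (h : G.EndsWithSection X Z n r s e) {i : ℕ} (hi : s ≤ i)
    (hin : i < n) : G.IsColliderNode n r i ↔ i = s ∧ e = .dashed := by
  have hu := h.und i hi hin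
  have he := h.entry
  constructor
  · rintro ⟨h1, h2, h3⟩
    have hd : G.dashed (r (i - 1)) (r i) := by
      rcases h3 with h3 | h3
      · exact h3.1
      · exact absurd h3.1 (not_dashed_of_und hu.symm)
    rcases hi.eq_or_lt with rfl | hi
    · refine ⟨rfl, ?_⟩
      cases e with
      | tail =>
        rcases he with he | ⟨-, he | he⟩
        · omega
        · exact absurd hd (not_dashed_symm_of_solid he)
        · exact absurd hd (not_dashed_of_dashed he)
      | dashed => rfl
      | solid => exact absurd hd (not_dashed_of_solid he.2)
    · have hu' := h.und (i - 1) (by omega) (by omega)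
      rw [Nat.sub_add_cancel (by omega)] at hu'
      exact absurd hd (not_dashed_of_und hu')
  · rintro ⟨rfl, rfl⟩
    exact ⟨he.1, hin, .inl ⟨he.2, .inr (.inl hu)⟩⟩

/-- Before a dashed arrow traversed backwards, any preceding undirected edge or incoming arrow makes
the node a collider. The excluded case is a one-node subroute entered as `tail`. -/
theorem isColliderNode_last (h : G.EndsWithSection X Z n r s e) (hr : ∀ i ≤ n, r' i = r i)
    (hd : G.dashed (r' (n + 1)) (r n)) (ht : s < n ∨ e ≠ .tail) :
    G.IsColliderNode (n + 1) r' n := by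
  have he := h.entry
  have h1 : 1 ≤ n ∧ (G.dashed (r (n - 1)) (r n) ∨ G.und.Adj (r n) (r (n - 1)) ∨
      G.solid (r (n - 1)) (r n)) := by
    rcases h.le.eq_or_lt with rfl | hs
    · cases e with
      | tail => simp at ht
      | dashed => exact ⟨he.1, .inl he.2⟩
      | solid => exact ⟨he.1, .inr (.inr he.2)⟩
    · have hu := h.und (n - 1) (by omega) (by omega)
      rw [Nat.sub_add_cancel (by omega)] at hu
      exact ⟨by omega, .inr (.inl hu.symm)⟩
  refine ⟨h1.1, le_rfl, .inr ?_⟩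
  rw [hr n le_rfl, hr (n - 1) (by omega)]
  exact ⟨hd, h1.2⟩

/-- If the nodes of the last undirected subroute are outside `Z`, except for a collider node at its
beginning, then the route is open. -/
theorem isOpen (h : G.EndsWithSection X Z n r s e)
    (hZ : ∀ i, s ≤ i → i ≤ n → (r i ∈ Z ↔ i = s ∧ e = .dashed ∧ s < n)) : G.IsOpen Z n r := by
  have hle := h.le
  refine ⟨fun i hc => ?_, fun j k hjk => ?_, fun i hi hc hs => ?_⟩
  · rcases lt_or_ge i s with hi | hi
    · exact h.before.node i hi hc
    · have hin : i < n := hc.2.1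
      have := (h.isColliderNode_iff_of_lt hi hin).1 hc
      exact (hZ i hi hin.le).2 ⟨this.1, this.2, by omega⟩
  · rcases lt_or_ge k s with hk | hk
    · exact h.before.sect j k hk hjk
    · exact absurd hjk.2.2.2.2.2 (not_solid_of_und (h.und k hk hjk.2.2.1).symm)
  · rcases lt_or_ge i s with his | his
    · exact h.before.other i his hc hs
    · rw [hZ i his hi]
      rintro ⟨rfl, rfl, hn⟩
      exact hc ((h.isColliderNode_iff_of_lt le_rfl hn).2 ⟨rfl, rfl⟩)

/-- Traversing a solid arrow backwards after the last undirected subroute. -/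
theorem openBefore_of_solid (h : G.EndsWithSection X Z n r s e) (hr : ∀ i ≤ n, r' i = r i)
    (hv : G.solid (r' (n + 1)) (r n))
    (hZ : e ≠ .solid → ∀ i, s ≤ i → i ≤ n → (r i ∈ Z ↔ i = s ∧ e = .dashed))
    (hZ' : e = .solid → ∃ i, s ≤ i ∧ i ≤ n ∧ r i ∈ Z) : G.OpenBefore Z (n + 1) r' (n + 1) := by
  have hle := h.le
  have hb := h.before.extend hr hle
  have hlast : s = n → (G.IsColliderNode (n + 1) r' n ↔ e = .dashed) := by
    rintro rfl
    have he := h.entry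
    constructor
    · rintro ⟨h1, -, h2⟩
      rw [hr s le_rfl, hr (s - 1) (by omega)] at h2
      rcases h2 with h2 | h2
      · cases e with
        | tail =>
          rcases he with he | ⟨-, he | he⟩
          · omega
          · exact absurd h2.1 (not_dashed_symm_of_solid he)
          · exact absurd h2.1 (not_dashed_of_dashed he)
        | dashed => rfl
        | solid => exact absurd h2.1 (not_dashed_of_solid he.2)
      · exact absurd h2.1 (not_dashed_of_solid hv)
    · rintro rfl
      refine ⟨he.1, le_rfl, .inl ?_⟩
      rw [hr s le_rfl, hr (s - 1) (by omega)]
      exact ⟨he.2, .inr (.inr hv)⟩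
  -- The last node now lies between an undirected edge and a solid arrowhead, and no collider
  -- pattern has this shape.
  have hlast' : s < n → ¬ G.IsColliderNode (n + 1) r' n := by
    rintro hs ⟨h1, -, h2⟩
    rw [hr n le_rfl, hr (n - 1) (by omega)] at h2
    have hu := h.und (n - 1) (by omega) (by omega)
    rw [Nat.sub_add_cancel (by omega)] at hu
    rcases h2 with h2 | h2
    · exact not_dashed_of_und hu h2.1
    · exact not_dashed_of_solid hv h2.1
  have hiff : ∀ i, s ≤ i → i ≤ n → (G.IsColliderNode (n + 1) r' i ↔ i = s ∧ e = .dashed) := by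
    intro i hi hin
    rcases hin.eq_or_lt with rfl | hin
    · rcases hi.eq_or_lt with rfl | hi
      · simp [hlast rfl]
      · simp [hlast' hi, hi.ne']
    · rw [isColliderNode_congr hr hin, h.isColliderNode_iff_of_lt hi hin]
  refine ⟨fun i hi hc => ?_, fun j k hk hjk => ?_, fun i hi hc hs => ?_⟩
  · rcases lt_or_ge i s with his | his
    · exact hb.node i his hc
    · have hc' := (hiff i his (by omega)).1 hc
      rw [hr i (by omega)]
      exact (hZ (by simp [hc'.2]) i his (by omega)).2 hc'
  · rcases lt_or_ge k s with hks | hks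
    · exact hb.sect j k hks hjk
    · obtain ⟨rfl, rfl, he, -⟩ := h.eq_of_isColliderSection hr hjk hks
      obtain ⟨i, h1, h2, h3⟩ := hZ' he
      exact ⟨i, h1, h2, by rwa [hr i h2]⟩
  · rcases lt_or_ge i s with his | his
    · exact hb.other i his hc hs
    · have he : e ≠ .solid := by
        rintro rfl
        refine hs ⟨s, n, ⟨h.entry.1, hle, le_rfl, fun i hi hi' => ?_, ?_, ?_⟩, his, by omega⟩
        · rw [hr i (by omega), hr (i + 1) (by omega)]
          exact h.und i hi hi'
        · rw [hr s hle, hr (s - 1) (by omega)]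
          exact h.entry.2
        · rwa [hr n le_rfl]
      rw [hr i (by omega), hZ he i his (by omega)]
      rwa [hiff i his (by omega)] at hc

/-- Traversing a dashed arrow backwards after the last undirected subroute. -/
theorem openBefore_of_dashed (h : G.EndsWithSection X Z n r s e) (hr : ∀ i ≤ n, r' i = r i)
    (hv : G.dashed (r' (n + 1)) (r n))
    (hZ : ∀ i, s ≤ i → i < n → (r i ∈ Z ↔ i = s ∧ e = .dashed))
    (hZ' : r n ∈ Z ↔ s < n ∨ e ≠ .tail) : G.OpenBefore Z (n + 1) r' (n + 1) := by
  have hle := h.le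
  have hb := h.before.extend hr hle
  refine ⟨fun i hi hc => ?_, fun j k hk hjk => ?_, fun i hi hc hs => ?_⟩
  · rcases lt_or_ge i s with his | his
    · exact hb.node i his hc
    · rw [hr i (by omega)]
      rcases (Nat.lt_succ_iff.1 hi).eq_or_lt with rfl | hin
      · rw [hZ']
        by_contra! ht
        obtain ⟨hs', rfl⟩ := ht
        obtain rfl : s = i := by omega
        obtain ⟨h1, -, h2⟩ := hc
        rw [hr s le_rfl, hr (s - 1) (by omega)] at h2
        have h3 : G.dashed (r (s - 1)) (r s) ∨ G.und.Adj (r s) (r (s - 1)) ∨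
            G.solid (r (s - 1)) (r s) := by
          rcases h2 with h2 | h2
          · exact .inl h2.1
          · exact h2.2
        rcases h.entry with he | ⟨-, he | he⟩
        · omega
        · rcases h3 with h3 | h3 | h3
          · exact not_dashed_symm_of_solid he h3
          · exact not_solid_of_und h3 he
          · exact not_solid_of_solid he h3
        · rcases h3 with h3 | h3 | h3
          · exact not_dashed_of_dashed he h3
          · exact not_dashed_of_und h3 he
          · exact not_dashed_symm_of_solid h3 he
      · rw [hZ i his hin]
        exact (h.isColliderNode_iff_of_lt his hin).1 ((isColliderNode_congr hr hin).1 hc)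
  · rcases lt_or_ge k s with hks | hks
    · exact hb.sect j k hks hjk
    · obtain ⟨-, -, -, h4⟩ := h.eq_of_isColliderSection hr hjk hks
      exact absurd hv (not_dashed_of_solid h4)
  · rcases lt_or_ge i s with his | his
    · exact hb.other i his hc hs
    · rw [hr i (by omega)]
      rcases (Nat.lt_succ_iff.1 hi).eq_or_lt with rfl | hin
      · rw [hZ']
        exact fun ht => hc (h.isColliderNode_last hr hv ht)
      · rw [hZ i his hin]
        exact fun h' => hc ((isColliderNode_congr hr hin).2
          ((h.isColliderNode_iff_of_lt his hin).2 h'))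

end EndsWithSection

/-- Traversing an arrow after an open route. -/
theorem IsOpen.openBefore {Z : Finset V} {n : ℕ} {r r' : ℕ → V} (h : G.IsOpen Z n r)
    (hr : ∀ i ≤ n, r' i = r i)
    (hv : G.solid (r n) (r' (n + 1)) ∨ G.dashed (r n) (r' (n + 1))) :
    G.OpenBefore Z (n + 1) r' (n + 1) := by
  obtain ⟨h1, h2, h3⟩ := h
  refine ⟨fun i hi hc => ?_, fun j k hk hjk => ?_, fun i hi hc hs => ?_⟩
  · rw [hr i (by omega)]
    rcases (Nat.lt_succ_iff.1 hi).eq_or_lt with rfl | hin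
    · exfalso
      obtain ⟨-, -, hc⟩ := hc
      rw [hr i le_rfl, hr (i - 1) (by omega)] at hc
      have hc' : G.dashed (r' (i + 1)) (r i) ∨ G.und.Adj (r i) (r' (i + 1)) ∨
          G.solid (r' (i + 1)) (r i) := by
        rcases hc with hc | hc
        · exact hc.2
        · exact .inl hc.1
      rcases hv with hv | hv <;> rcases hc' with hc | hc | hc
      · exact not_dashed_symm_of_solid hv hc
      · exact not_solid_of_und hc hv
      · exact not_solid_of_solid hv hc
      · exact not_dashed_of_dashed hv hc
      · exact not_dashed_of_und hc hv
      · exact not_dashed_symm_of_solid hc hv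
    · exact h1 i ((isColliderNode_congr hr hin).1 hc)
  · rcases (Nat.lt_succ_iff.1 hk).eq_or_lt with rfl | hkn
    · have h6 := hjk.2.2.2.2.2
      rw [hr k le_rfl] at h6
      rcases hv with hv | hv
      · exact absurd h6 (not_solid_of_solid hv)
      · exact absurd hv (not_dashed_symm_of_solid h6)
    · obtain ⟨i, h4, h5, h6⟩ := h2 j k ((isColliderSection_congr hr hkn).1 hjk)
      exact ⟨i, h4, h5, by rwa [hr i (by omega)]⟩
  · rw [hr i (by omega)]
    refine h3 i (by omega) (fun hc' => hc ((isColliderNode_congr hr hc'.2.1).2 hc')) ?_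
    rintro ⟨j, k, hjk, h4, h5⟩
    exact hs ⟨j, k, (isColliderSection_congr hr hjk.2.2.1).2 hjk, h4, h5⟩

end UCG

/-! ### Dependencies between unknowns as steps of open routes -/

/-- The kinds of unknowns, at every node, of the linear system that determines the residual of a
node given `Z`. -/
inductive FlowKind
  | value
  | noise
  | score
  | dual
  | mean
  deriving DecidableEq

instance : Finite FlowKind :=
  Finite.of_surjective (fun i : Fin 5 => ![.value, .noise, .score, .dual, .mean] i) fun
    | .value => ⟨0, rfl⟩
    | .noise => ⟨1, rfl⟩
    | .score => ⟨2, rfl⟩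
    | .dual => ⟨3, rfl⟩
    | .mean => ⟨4, rfl⟩

namespace UCG

open FlowKind

variable {V : Type*} {G : UCG V}

/-- `FlowStep G Z q u q' v` says that the unknown of kind `q` at `u` may occur in the equation for
the unknown of kind `q'` at `v`. -/
inductive FlowStep (G : UCG V) (Z : Finset V) : FlowKind × V → FlowKind × V → Prop
  | noise_value {v} : v ∉ Z → FlowStep G Z (noise, v) (value, v)
  | value_value {u v} : G.dashed u v → v ∉ Z → FlowStep G Z (value, u) (value, v)
  | score_noise {v} : v ∉ Z → FlowStep G Z (score, v) (noise, v)
  | value_noise_of_solid {u v} : G.solid u v → v ∉ Z → FlowStep G Z (value, u) (noise, v)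
  | noise_noise {u v} : G.und.Adj u v → v ∉ Z → FlowStep G Z (noise, u) (noise, v)
  | value_noise_of_dashed {u v} : G.dashed u v → v ∈ Z → FlowStep G Z (value, u) (noise, v)
  | noise_score {v} : v ∈ Z → FlowStep G Z (noise, v) (score, v)
  | noise_score_of_und {u v} : G.und.Adj u v → v ∈ Z → FlowStep G Z (noise, u) (score, v)
  | value_score {u v} : G.solid u v → v ∈ Z → FlowStep G Z (value, u) (score, v)
  | score_score {u v} : G.dashed v u → v ∉ Z → FlowStep G Z (score, u) (score, v)
  | dual_score {u v} : G.solid v u → v ∉ Z → FlowStep G Z (dual, u) (score, v)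
  | score_dual {v} : v ∉ Z → FlowStep G Z (score, v) (dual, v)
  | dual_dual {u v} : G.und.Adj u v → v ∉ Z → FlowStep G Z (dual, u) (dual, v)
  | noise_dual {v} : v ∈ Z → FlowStep G Z (noise, v) (dual, v)
  | mean_dual {v} : v ∈ Z → FlowStep G Z (mean, v) (dual, v)
  | mean_mean {u v} : G.und.Adj u v → FlowStep G Z (mean, u) (mean, v)
  | value_mean {u v} : G.solid u v → FlowStep G Z (value, u) (mean, v)

/-- The routes from `X` to `v` that correspond to the unknown of the given kind at `v`. -/
def FlowRoute (G : UCG V) (X Z : Finset V) : FlowKind × V → Prop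
  | (value, v) => ∃ n r, r n = v ∧ r 0 ∈ X ∧ G.IsRoute n r ∧ G.IsOpen Z n r
  | (noise, v) => ∃ n r s e, r n = v ∧ G.EndsWithSection X Z n r s e ∧
      ∀ i, s ≤ i → i ≤ n → (r i ∈ Z ↔ i = s ∧ e = .dashed)
  | (score, v) => ∃ n r s e, r n = v ∧ G.EndsWithSection X Z n r s e ∧
      (∀ i, s ≤ i → i < n → (r i ∈ Z ↔ i = s ∧ e = .dashed)) ∧
      (r n ∈ Z ↔ s < n ∨ e ≠ .tail)
  | (dual, v) => ∃ n r s e, r n = v ∧ G.EndsWithSection X Z n r s e ∧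
      (e ≠ .solid → ∀ i, s ≤ i → i ≤ n → (r i ∈ Z ↔ i = s ∧ e = .dashed)) ∧
      (e = .solid → ∃ i, s ≤ i ∧ i ≤ n ∧ r i ∈ Z)
  | (mean, v) => ∃ n r s, r n = v ∧ G.EndsWithSection X Z n r s .solid

/-- A forward arrow closes the old undirected subroute and opens a new one consisting of the single
node `v`. -/
theorem IsOpen.exists_endsWithSection {X Z : Finset V} {n : ℕ} {r : ℕ → V} {v : V}
    (h : G.IsOpen Z n r) (h0 : r 0 ∈ X) (hr : G.IsRoute n r) {e : Entry}
    (hv : e = .solid ∧ G.solid (r n) v ∨ e = .dashed ∧ G.dashed (r n) v) :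
    ∃ n' r', r' n' = v ∧ G.EndsWithSection X Z n' r' n' e := by
  refine ⟨n + 1, snoc n r v, snoc_succ, ?_⟩
  have hv' : G.solid (r n) v ∨ G.dashed (r n) v := hv.imp And.right And.right
  refine ⟨hr.extend snoc_of_le ?_, ?_, le_rfl, fun i hi hi' => by omega,
    h.openBefore snoc_of_le (by rwa [snoc_succ]), ?_⟩
  · rw [snoc_succ]
    rcases hv' with hv | hv
    · exact .inl hv
    · exact .inr (.inr (.inl hv))
  · rwa [snoc_of_le 0 (by omega)]
  · rcases hv with ⟨rfl, hv⟩ | ⟨rfl, hv⟩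
    all_goals
      refine ⟨by omega, ?_⟩
      rwa [Nat.add_sub_cancel, snoc_of_le n le_rfl, snoc_succ]

/-- A backward arrow opens a new one-node subroute entered as `tail`; that the nodes before it are
in order is the hypothesis `hb`. -/
theorem EndsWithSection.exists_backwards {X Z : Finset V} {n s : ℕ} {r : ℕ → V} {e : Entry} {v : V}
    (h : G.EndsWithSection X Z n r s e) (hv : G.solid v (r n) ∨ G.dashed v (r n))
    (hb : G.OpenBefore Z (n + 1) (snoc n r v) (n + 1)) :
    ∃ n' r', r' n' = v ∧ G.EndsWithSection X Z n' r' n' .tail := by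
  refine ⟨n + 1, snoc n r v, snoc_succ, h.route.extend snoc_of_le ?_, ?_, le_rfl,
    fun i hi hi' => by omega, hb, ?_⟩
  · rw [snoc_succ]
    rcases hv with hv | hv
    · exact .inr (.inl hv)
    · exact .inr (.inr (.inr (.inl hv)))
  · rw [snoc_of_le 0 (by omega)]
    exact h.start
  · refine .inr ⟨by omega, ?_⟩
    rwa [Nat.add_sub_cancel, snoc_of_le n le_rfl, snoc_succ]

theorem flowRoute_start {X Z : Finset V} {x : V} (hx : x ∈ X) (hxZ : x ∉ Z) :
    G.FlowRoute X Z (score, x) := by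
  refine ⟨0, fun _ => x, 0, .tail, rfl, ⟨fun i hi => by omega, hx, le_rfl, fun i hi hi' => by omega,
    ⟨fun i hi => by omega, fun j k hk => by omega, fun i hi => by omega⟩, .inl rfl⟩,
    fun i hi hi' => by omega, by simpa using hxZ⟩

/-- A `score` route is one that may continue backwards along a dashed arrow. If its last node is
outside `Z`, this node must not become a collider, which leaves only the one-node subroute with
`tail` entry. -/
theorem FlowRoute.score_dual {X Z : Finset V} {v : V} (hv : v ∉ Z)
    (h : G.FlowRoute X Z (score, v)) :
    ∃ n r e, r n = v ∧ G.EndsWithSection X Z n r n e ∧ e = .tail := by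
  obtain ⟨n, r, s, e, rfl, h, -, h2⟩ := h
  rw [iff_false_left hv] at h2
  have hs : s = n := by
    have := h.le
    by_contra
    exact h2 (.inl (by omega))
  subst hs
  refine ⟨s, r, e, rfl, h, ?_⟩
  by_contra he
  exact h2 (.inr he)

/-- The kinds act as states of an automaton reading the route. `value` is an open route; `noise`
ends in a subroute without nodes of `Z`, except a collider at a dashed entry; `score` and `dual` may
be continued backwards along a dashed or a solid arrow, respectively; `mean` ends in a subroute
entered by a solid arrow, with no condition on its nodes yet. -/
theorem FlowRoute.step {X Z : Finset V} {a b : FlowKind × V} (h : G.FlowRoute X Z a)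
    (hab : G.FlowStep Z a b) : G.FlowRoute X Z b := by
  cases hab with
  | noise_value hv =>
    obtain ⟨n, r, s, e, rfl, h, h1⟩ := h
    refine ⟨n, r, rfl, h.start, h.route, h.isOpen fun i hi hi' => ?_⟩
    rw [h1 i hi hi']
    constructor
    · rintro ⟨rfl, rfl⟩
      -- A one-node subroute with dashed entry would place `v` in `Z`, so the exceptional node is
      -- not the last one.
      refine ⟨rfl, rfl, lt_of_le_of_ne hi' ?_⟩
      rintro rfl
      exact hv ((h1 i le_rfl le_rfl).2 ⟨rfl, rfl⟩)
    · exact fun h => ⟨h.1, h.2.1⟩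
  | @value_value u v hd hv =>
    obtain ⟨n, r, rfl, h0, hr, h⟩ := h
    obtain ⟨n', r', rfl, h'⟩ := h.exists_endsWithSection h0 hr (.inr ⟨rfl, hd⟩)
    refine ⟨n', r', rfl, h'.start, h'.route, h'.isOpen fun i hi hi' => ?_⟩
    obtain rfl : i = n' := by omega
    simp [hv]
  | score_noise hv =>
    obtain ⟨n, r, e, rfl, h, rfl⟩ := h.score_dual hv
    refine ⟨n, r, n, .tail, rfl, h, fun i hi hi' => ?_⟩
    obtain rfl : i = n := by omega
    simp [hv]
  | value_noise_of_solid hs hv =>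
    obtain ⟨n, r, rfl, h0, hr, h⟩ := h
    obtain ⟨n', r', rfl, h'⟩ := h.exists_endsWithSection h0 hr (.inl ⟨rfl, hs⟩)
    refine ⟨n', r', n', .solid, rfl, h', fun i hi hi' => ?_⟩
    obtain rfl : i = n' := by omega
    simp [hv]
  | @noise_noise u v hu hv =>
    obtain ⟨n, r, s, e, rfl, h, h1⟩ := h
    refine ⟨n + 1, snoc n r v, s, e, snoc_succ,
      h.extend_und snoc_of_le (by rwa [snoc_succ]), fun i hi hi' => ?_⟩
    rcases hi'.eq_or_lt with rfl | hi'
    · have := h.le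
      rw [snoc_succ, iff_false_left hv]
      rintro ⟨rfl, -⟩
      omega
    · rw [snoc_of_le i (by omega), h1 i hi (by omega)]
  | value_noise_of_dashed hd hv =>
    obtain ⟨n, r, rfl, h0, hr, h⟩ := h
    obtain ⟨n', r', rfl, h'⟩ := h.exists_endsWithSection h0 hr (.inr ⟨rfl, hd⟩)
    refine ⟨n', r', n', .dashed, rfl, h', fun i hi hi' => ?_⟩
    obtain rfl : i = n' := by omega
    simp [hv]
  | noise_score hv =>
    obtain ⟨n, r, s, e, rfl, h, h1⟩ := h
    -- Since `v ∈ Z`, the last node is the exceptional one: the subroute is a single node entered by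
    -- a dashed arrow.
    obtain ⟨rfl, rfl⟩ := (h1 n h.le le_rfl).1 hv
    exact ⟨n, r, n, .dashed, rfl, h, fun i hi hi' => by omega, by simp [hv]⟩
  | @noise_score_of_und u v hu hv =>
    obtain ⟨n, r, s, e, rfl, h, h1⟩ := h
    refine ⟨n + 1, snoc n r v, s, e, snoc_succ,
      h.extend_und snoc_of_le (by rwa [snoc_succ]), fun i hi hi' => ?_, ?_⟩
    · rw [snoc_of_le i (by omega), h1 i hi (by omega)]
    · have := h.le
      rw [snoc_succ, iff_true_left hv]
      exact .inl (by omega)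
  | value_score hs hv =>
    obtain ⟨n, r, rfl, h0, hr, h⟩ := h
    obtain ⟨n', r', rfl, h'⟩ := h.exists_endsWithSection h0 hr (.inl ⟨rfl, hs⟩)
    exact ⟨n', r', n', .solid, rfl, h', fun i hi hi' => by omega, by simp [hv]⟩
  | @score_score u v hd hv =>
    obtain ⟨n, r, s, e, rfl, h, h1, h2⟩ := h
    obtain ⟨n', r', rfl, h'⟩ := h.exists_backwards (.inr hd)
      (h.openBefore_of_dashed snoc_of_le (by rwa [snoc_succ]) h1 h2)
    exact ⟨n', r', n', .tail, rfl, h', fun i hi hi' => by omega, by simp [hv]⟩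
  | @dual_score u v hs hv =>
    obtain ⟨n, r, s, e, rfl, h, h1, h2⟩ := h
    obtain ⟨n', r', rfl, h'⟩ := h.exists_backwards (.inl hs)
      (h.openBefore_of_solid snoc_of_le (by rwa [snoc_succ]) h1 h2)
    exact ⟨n', r', n', .tail, rfl, h', fun i hi hi' => by omega, by simp [hv]⟩
  | score_dual hv =>
    obtain ⟨n, r, e, rfl, h, rfl⟩ := h.score_dual hv
    refine ⟨n, r, n, .tail, rfl, h, fun _ i hi hi' => ?_, by simp⟩
    obtain rfl : i = n := by omega
    simp [hv]
  | @dual_dual u v hu hv =>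
    obtain ⟨n, r, s, e, rfl, h, h1, h2⟩ := h
    refine ⟨n + 1, snoc n r v, s, e, snoc_succ,
      h.extend_und snoc_of_le (by rwa [snoc_succ]), fun he i hi hi' => ?_, fun he => ?_⟩
    · rcases hi'.eq_or_lt with rfl | hi'
      · have := h.le
        rw [snoc_succ, iff_false_left hv]
        rintro ⟨rfl, -⟩
        omega
      · rw [snoc_of_le i (by omega), h1 he i hi (by omega)]
    · obtain ⟨i, h3, h4, h5⟩ := h2 he
      exact ⟨i, h3, by omega, by rwa [snoc_of_le i h4]⟩
  | noise_dual hv =>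
    obtain ⟨n, r, s, e, rfl, h, h1⟩ := h
    obtain ⟨rfl, rfl⟩ := (h1 n h.le le_rfl).1 hv
    exact ⟨n, r, n, .dashed, rfl, h, fun _ => h1, by simp⟩
  | mean_dual hv =>
    obtain ⟨n, r, s, rfl, h⟩ := h
    -- The node `v ∈ Z` is the one that opens the collider section created by a backward solid
    -- arrow.
    exact ⟨n, r, s, .solid, rfl, h, by simp, fun _ => ⟨n, h.le, le_rfl, hv⟩⟩
  | @mean_mean u v hu =>
    obtain ⟨n, r, s, rfl, h⟩ := h
    exact ⟨n + 1, snoc n r v, s, snoc_succ, h.extend_und snoc_of_le (by rwa [snoc_succ])⟩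
  | value_mean hs =>
    obtain ⟨n, r, rfl, h0, hr, h⟩ := h
    obtain ⟨n', r', rfl, h'⟩ := h.exists_endsWithSection h0 hr (.inl ⟨rfl, hs⟩)
    exact ⟨n', r', n', rfl, h'⟩

/-- If the unknown `value` at `y` depends on the source term at `x`, then there is an open route
from `x` to `y`. -/
theorem not_separated_of_flowStep {X Y Z : Finset V} {x y : V} (hx : x ∈ X) (hy : y ∈ Y)
    (hxZ : x ∉ Z) (h : Relation.ReflTransGen (G.FlowStep Z) (score, x) (value, y)) :
    ¬ G.Separated X Y Z := by
  have key : G.FlowRoute X Z (value, y) := by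
    refine Relation.ReflTransGen.rec (motive := fun b _ => G.FlowRoute X Z b) ?_ ?_ h
    · exact flowRoute_start hx hxZ
    · exact fun _ hs ih => ih.step hs
  obtain ⟨n, r, h1, h0, hr, ho⟩ := key
  exact fun hs => hs ⟨n, r, hr, h0, h1 ▸ hy, ho⟩

end UCG

/-! ### The linear system and the zeros of its solution -/

namespace UCG

open FlowKind Matrix

variable {V : Type*} [Fintype V] {G : UCG V}

theorem mulVec_apply_eq_zero {A : Matrix V V ℝ} {x : V → ℝ} {v : V}
    (h : ∀ w, A v w ≠ 0 → x w = 0) : (A *ᵥ x) v = 0 :=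
  Finset.sum_eq_zero fun w _ => mul_eq_zero.2 (or_iff_not_imp_left.2 (h w))

variable [DecidableEq V]

/-- The linear system that determines the residual of a node given `Z`, in the linear model with
coefficients `β` of the mothers, coefficients `S` of the fathers and concentration matrix `M`. -/
noncomputable def flowMap (M β S : Matrix V V ℝ) (Z : Finset V) :
    (FlowKind × V → ℝ) →ₗ[ℝ] FlowKind × V → ℝ where
  toFun u
    | (value, v) => if v ∈ Z then u (value, v) else
        u (value, v) - u (noise, v) - (β *ᵥ fun w => u (value, w)) v
    | (noise, v) => if v ∈ Z then u (noise, v) + (β *ᵥ fun w => u (value, w)) v else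
        (M *ᵥ fun w => u (noise, w)) v - (S *ᵥ fun w => u (value, w)) v - u (score, v)
    | (score, v) => if v ∈ Z then
          u (score, v) - (M *ᵥ fun w => u (noise, w)) v + (S *ᵥ fun w => u (value, w)) v else
        u (score, v) - (βᵀ *ᵥ fun w => u (score, w)) v - (Sᵀ *ᵥ fun w => u (dual, w)) v
    | (dual, v) => if v ∈ Z then u (dual, v) - u (noise, v) + u (mean, v) else
        (M *ᵥ fun w => u (dual, w)) v - u (score, v)
    | (mean, v) => (M *ᵥ fun w => u (mean, w)) v - (S *ᵥ fun w => u (value, w)) v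
  map_add' u u' := by
    have h (A : Matrix V V ℝ) (q : FlowKind) :
        (A *ᵥ fun w => u (q, w) + u' (q, w)) =
          (A *ᵥ fun w => u (q, w)) + A *ᵥ fun w => u' (q, w) := by
      rw [← mulVec_add]; rfl
    ext ⟨q, v⟩
    cases q <;> simp only [Pi.add_apply, h] <;> (try split_ifs) <;> ring
  map_smul' c u := by
    have h (A : Matrix V V ℝ) (q : FlowKind) :
        (A *ᵥ fun w => c * u (q, w)) = c • A *ᵥ fun w => u (q, w) := by
      rw [← mulVec_smul]; rfl
    ext ⟨q, v⟩
    cases q <;> simp only [Pi.smul_apply, smul_eq_mul, h, RingHom.id_apply] <;> (try split_ifs) <;> ring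

section

variable {M β S Sg : Matrix V V ℝ} {Z : Finset V}

/-- The flow system is compatible with the dependencies described by `FlowStep`. -/
theorem flowMap_apply_eq_zero (hM : ∀ i j, M i j ≠ 0 → i = j ∨ G.und.Adj i j)
    (hβ : ∀ i j, β i j ≠ 0 → G.dashed j i) (hS : ∀ i j, S i j ≠ 0 → G.solid j i)
    {R : Set (FlowKind × V)} (hR : ∀ s t, s ∈ R → G.FlowStep Z s t → t ∈ R)
    {u : FlowKind × V → ℝ} (hu : ∀ t ∉ R, u t = 0) (s : FlowKind × V) (hs : s ∉ R) :
    flowMap M β S Z u s = 0 := by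
  have hz : ∀ t, G.FlowStep Z t s → u t = 0 := fun t ht => hu t fun h => hs (hR t s h ht)
  have hus : u s = 0 := hu s hs
  obtain ⟨q, v⟩ := s
  cases q <;> simp only [flowMap, LinearMap.coe_mk, AddHom.coe_mk] <;> (try split_ifs with hv)
  · exact hus
  · rw [hus, hz _ (.noise_value hv),
      mulVec_apply_eq_zero fun w hw => hz _ (.value_value (hβ v w hw) hv)]
    ring
  · rw [hus, mulVec_apply_eq_zero fun w hw => hz _ (.value_noise_of_dashed (hβ v w hw) hv)]
    ring
  · rw [mulVec_apply_eq_zero fun w hw => ?_,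
      mulVec_apply_eq_zero fun w hw => hz _ (.value_noise_of_solid (hS v w hw) hv),
      hz _ (.score_noise hv)]
    · ring
    · rcases hM v w hw with rfl | hw
      · exact hus
      · exact hz _ (.noise_noise hw.symm hv)
  · rw [hus, mulVec_apply_eq_zero fun w hw => ?_,
      mulVec_apply_eq_zero fun w hw => hz _ (.value_score (hS v w hw) hv)]
    · ring
    · rcases hM v w hw with rfl | hw
      · exact hz _ (.noise_score hv)
      · exact hz _ (.noise_score_of_und hw.symm hv)
  · rw [hus, mulVec_apply_eq_zero fun w hw => hz _ (.score_score (hβ w v hw) hv),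
      mulVec_apply_eq_zero fun w hw => hz _ (.dual_score (hS w v hw) hv)]
    ring
  · rw [hus, hz _ (.noise_dual hv), hz _ (.mean_dual hv)]
    ring
  · rw [hz _ (.score_dual hv), mulVec_apply_eq_zero fun w hw => ?_]
    · ring
    · rcases hM v w hw with rfl | hw
      · exact hus
      · exact hz _ (.dual_dual hw.symm hv)
  · rw [mulVec_apply_eq_zero fun w hw => ?_,
      mulVec_apply_eq_zero fun w hw => hz _ (.value_mean (hS v w hw))]
    · ring
    · rcases hM v w hw with rfl | hw
      · exact hus
      · exact hz _ (.mean_mean hw.symm)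

/-- A solution of the flow system, up to the equations for `score` outside `Z`, describes the
covariances of a linear combination of the coordinates. -/
theorem flowMap_solution (hMpos : M.PosDef)
    (hT : (M * (1 - β) - S) * Sg * (M * (1 - β) - S)ᵀ = M) {u : FlowKind × V → ℝ}
    (hu : ∀ q v, (q = score → v ∈ Z) → flowMap M β S Z u (q, v) = 0) :
    (∀ v ∈ Z, u (value, v) = 0) ∧
    (fun v => u (noise, v)) = (1 - β) *ᵥ (fun v => u (value, v)) ∧
    (fun v => u (score, v)) = (M * (1 - β) - S) *ᵥ (fun v => u (value, v)) ∧
    M *ᵥ (fun v => u (dual, v)) = (fun v => u (score, v)) ∧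
    M *ᵥ (fun v => u (mean, v)) = S *ᵥ (fun v => u (value, v)) ∧
    Sg *ᵥ ((fun v => u (score, v)) - βᵀ *ᵥ (fun v => u (score, v)) -
      Sᵀ *ᵥ (fun v => u (dual, v))) = fun v => u (value, v) := by
  set b : V → ℝ := fun v => u (value, v) with hb
  set y : V → ℝ := fun v => u (noise, v) with hy
  set m : V → ℝ := fun v => u (score, v) with hm
  set l : V → ℝ := fun v => u (dual, v) with hl
  set w : V → ℝ := fun v => u (mean, v) with hw
  have e1 : ∀ v ∈ Z, b v = 0 := fun v hv => by
    simpa [flowMap, hv] using hu value v (by simp)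
  have e2 : y = (1 - β) *ᵥ b := by
    ext v
    rw [sub_mulVec, one_mulVec, Pi.sub_apply]
    by_cases hv : v ∈ Z
    · have := hu noise v (by simp)
      simp only [flowMap, LinearMap.coe_mk, AddHom.coe_mk, if_pos hv] at this
      rw [e1 v hv]
      linarith
    · have := hu value v (by simp)
      simp only [flowMap, LinearMap.coe_mk, AddHom.coe_mk, if_neg hv] at this
      linarith
  have e3 : m = M *ᵥ y - S *ᵥ b := by
    ext v
    rw [Pi.sub_apply]
    by_cases hv : v ∈ Z
    · have := hu score v (fun _ => hv)
      simp only [flowMap, LinearMap.coe_mk, AddHom.coe_mk, if_pos hv] at this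
      linarith
    · have := hu noise v (by simp)
      simp only [flowMap, LinearMap.coe_mk, AddHom.coe_mk, if_neg hv] at this
      linarith
  have e4 : M *ᵥ w = S *ᵥ b := by
    ext v
    have := hu mean v (by simp)
    simp only [flowMap, LinearMap.coe_mk, AddHom.coe_mk] at this
    linarith
  have e5 : M *ᵥ (y - w) = m := by rw [mulVec_sub, e4, e3]
  -- The equations for `dual` say `l = y - w` on `Z`, and `M l = m = M (y - w)` off `Z`. Positive
  -- definiteness of `M` glues the two halves.
  have e6 : l = y - w := by
    rw [← sub_eq_zero]
    refine hMpos.eq_zero_of_mulVec_eq_zero_on (A := {v | v ∉ Z}) (fun v hv => ?_) fun v hv => ?_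
    · have hv : v ∈ Z := by simpa using hv
      have := hu dual v (by simp)
      simp only [flowMap, LinearMap.coe_mk, AddHom.coe_mk, if_pos hv] at this
      simp only [Pi.sub_apply]
      linarith
    · have hv : v ∉ Z := hv
      have := hu dual v (by simp)
      simp only [flowMap, LinearMap.coe_mk, AddHom.coe_mk, if_neg hv] at this
      rw [mulVec_sub, e5, Pi.sub_apply]
      linarith
  have e7 : M *ᵥ l = m := by rw [e6, e5]
  have e8 : m = (M * (1 - β) - S) *ᵥ b := by
    rw [e3, e2, mulVec_mulVec, ← sub_mulVec]
  refine ⟨e1, e2, e8, e7, e4, ?_⟩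
  set T := M * (1 - β) - S with hTdef
  have hMT : Mᵀ = M := hMpos.isHermitian
  have e9 : m - βᵀ *ᵥ m - Sᵀ *ᵥ l = Tᵀ *ᵥ l := by
    rw [hTdef, transpose_sub, transpose_mul, hMT, transpose_sub, transpose_one, sub_mulVec,
      ← mulVec_mulVec, e7, sub_mulVec, one_mulVec]
  have hdet : T.det ≠ 0 := fun h => by
    have := hMpos.det_pos
    rw [← hT, det_mul, det_mul, h] at this
    simp at this
  -- The candidate residual is `Tᵀ l`. By `T Sg Tᵀ = M`, its image under `Sg` is sent by `T` to `M l
  -- = m = T b`, and `T` is invertible.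
  have e10 : T *ᵥ (Sg *ᵥ Tᵀ *ᵥ l) = T *ᵥ b := by
    rw [mulVec_mulVec, mulVec_mulVec, hT, e7, e8]
  rw [e9]
  exact mulVec_injective_of_isUnit ((isUnit_iff_isUnit_det _).2 hdet.isUnit) e10

/-- For a homogeneous solution, the combination in the `score` equations is a vector supported on
`Z` whose image under `Sg` vanishes on `Z`. It is therefore zero, and all unknowns are recovered
from it. -/
theorem flowMap_injective (hSg : Sg.PosDef) (hMpos : M.PosDef)
    (hT : (M * (1 - β) - S) * Sg * (M * (1 - β) - S)ᵀ = M) :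
    Function.Injective (flowMap M β S Z) := by
  rw [injective_iff_map_eq_zero]
  intro u hu
  obtain ⟨h1, h2, h3, h4, h5, h6⟩ :=
    flowMap_solution hMpos hT fun q v _ => congrFun hu (q, v)
  have ha := hSg.eq_zero_of_mulVec_eq_zero_on (A := Z)
    (a := (fun v => u (score, v)) - βᵀ *ᵥ (fun v => u (score, v)) - Sᵀ *ᵥ (fun v => u (dual, v)))
    (fun v hv => by
      have hv : v ∉ Z := by simpa using hv
      have := congrFun hu (score, v)
      simpa [flowMap, hv] using this)
    (fun v hv => by rw [h6]; exact h1 v hv)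
  have hMinj := mulVec_injective_of_isUnit hMpos.isUnit
  have hb : (fun v => u (value, v)) = 0 := by rw [← h6, ha, mulVec_zero]
  have hy : (fun v => u (noise, v)) = 0 := by rw [h2, hb, mulVec_zero]
  have hm : (fun v => u (score, v)) = 0 := by rw [h3, hb, mulVec_zero]
  have hl : (fun v => u (dual, v)) = 0 := hMinj (by rw [h4, hm, mulVec_zero])
  have hw : (fun v => u (mean, v)) = 0 := hMinj (by rw [h5, hb, mulVec_zero, mulVec_zero])
  ext ⟨q, v⟩
  cases q
  · exact congrFun hb v
  · exact congrFun hy v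
  · exact congrFun hm v
  · exact congrFun hl v
  · exact congrFun hw v

/-- In a Gaussian model whose coefficients have the zeros prescribed by `G`, the residual of a node
given `Z` is uncorrelated with the nodes separated from it by `Z`. -/
theorem exists_isResidual_of_separated (hSg : Sg.PosDef) (hMpos : M.PosDef)
    (hT : (M * (1 - β) - S) * Sg * (M * (1 - β) - S)ᵀ = M)
    (hM : ∀ i j, M i j ≠ 0 → i = j ∨ G.und.Adj i j)
    (hβ : ∀ i j, β i j ≠ 0 → G.dashed j i) (hS : ∀ i j, S i j ≠ 0 → G.solid j i)
    {X Y : Finset V} (hsep : G.Separated X Y Z) {x y : V} (hx : x ∈ X) (hy : y ∈ Y) (hxZ : x ∉ Z) :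
    ∃ a, IsResidual Sg Z x a ∧ (Sg *ᵥ a) y = 0 := by
  set R : Set (FlowKind × V) := {t | Relation.ReflTransGen (G.FlowStep Z) (score, x) t} with hR
  let W : Submodule ℝ (FlowKind × V → ℝ) :=
    { carrier := {u | ∀ t ∉ R, u t = 0}
      add_mem' := fun {u u'} h h' t ht => by simp [h t ht, h' t ht]
      zero_mem' := fun t _ => rfl
      smul_mem' := fun c u h t ht => by simp [h t ht] }
  -- `W` consists of the vectors supported on the unknowns reachable from the source, and the system
  -- preserves it.
  have hW : ∀ u ∈ W, flowMap M β S Z u ∈ W := fun u hu =>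
    flowMap_apply_eq_zero hM hβ hS (fun s t hs hst => Relation.ReflTransGen.tail hs hst) hu
  -- An injective endomorphism of the finite-dimensional space `W` is onto, so the solution is found
  -- inside `W` without inverting the system.
  have hinj : Function.Injective ((flowMap M β S Z).restrict hW) := fun u u' h =>
    Subtype.ext (flowMap_injective hSg hMpos hT (congrArg Subtype.val h))
  have hsrc : Pi.single (score, x) 1 ∈ W := fun t ht =>
    
    Pi.single_eq_of_ne (fun h => ht (by rw [h]; exact Relation.ReflTransGen.refl)) 1
  obtain ⟨⟨u, huW⟩, hu⟩ := LinearMap.injective_iff_surjective.1 hinj ⟨_, hsrc⟩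
  replace hu : flowMap M β S Z u = Pi.single (score, x) 1 := congrArg Subtype.val hu
  -- The source sits in a `score` equation outside `Z`, the only equations that `flowMap_solution`
  -- does not require.
  obtain ⟨h1, -, -, -, -, h6⟩ := flowMap_solution (u := u) hMpos hT fun q v hqv => by
    rw [hu]
    refine Pi.single_eq_of_ne (fun h => ?_) 1
    rw [Prod.mk.injEq] at h
    exact hxZ (h.2 ▸ hqv h.1)
  refine ⟨(fun v => u (score, v)) - βᵀ *ᵥ (fun v => u (score, v)) -
    Sᵀ *ᵥ (fun v => u (dual, v)), ⟨?_, fun v hvx hvZ => ?_, fun z hz => ?_⟩, ?_⟩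
  · have := congrFun hu (score, x)
    simpa [flowMap, hxZ] using this
  · have := congrFun hu (score, v)
    simpa [flowMap, hvZ, hvx] using this
  · rw [h6]
    exact h1 z hz
  · rw [h6]
    exact huW _ fun h => not_separated_of_flowStep hx hy hxZ h hsep

end

end UCG

/-! ### Separations that hold in every UCG -/

namespace UCG

variable {V : Type*} {G : UCG V}

/-- The node `d` can be reached from the set `K` by a semidirected route whose first edge is an
arrow. -/
def StrictDescendant (G : UCG V) (K : Finset V) (d : V) : Prop :=
  ∃ k ∈ K, ∃ c, (G.solid k c ∨ G.dashed k c) ∧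
    Relation.ReflTransGen (fun c d => G.solid c d ∨ G.dashed c d ∨ G.und.Adj c d) c d

theorem StrictDescendant.tail {K : Finset V} {c d : V} (h : G.StrictDescendant K c)
    (hcd : G.solid c d ∨ G.dashed c d ∨ G.und.Adj c d) : G.StrictDescendant K d := by
  obtain ⟨k, hk, b, hb, hbc⟩ := h
  exact ⟨k, hk, b, hb, hbc.tail hcd⟩

theorem strictDescendant_of_arrow {K : Finset V} {k d : V} (hk : k ∈ K)
    (h : G.solid k d ∨ G.dashed k d) : G.StrictDescendant K d :=
  ⟨k, hk, d, h, .refl⟩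

theorem reflTransGen_of_reachable {a b : V} (h : G.und.Reachable a b) :
    Relation.ReflTransGen (fun c d => G.solid c d ∨ G.dashed c d ∨ G.und.Adj c d) a b := by
  have h' := (SimpleGraph.reachable_iff_reflTransGen a b).1 h
  clear h
  induction h' with
  | refl => exact .refl
  | tail _ h ih => exact ih.tail (.inr (.inr h))

section Families

variable [Fintype V]

theorem mem_Fa {X : Finset V} {b : V} : b ∈ G.Fa X ↔ ∃ a ∈ X, G.solid b a := by simp [Fa]

theorem mem_Mo {X : Finset V} {b : V} : b ∈ G.Mo X ↔ ∃ a ∈ X, G.dashed b a := by simp [Mo]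

theorem mem_Ne {X : Finset V} {b : V} : b ∈ G.Ne X ↔ ∃ a ∈ X, G.und.Adj b a := by simp [Ne]

variable [DecidableEq V]

theorem mem_Pa {X : Finset V} {b : V} : b ∈ G.Pa X ↔ ∃ a ∈ X, G.solid b a ∨ G.dashed b a := by
  rw [Pa, Finset.mem_union, mem_Fa, mem_Mo]
  constructor
  · rintro (⟨a, ha, h⟩ | ⟨a, ha, h⟩)
    · exact ⟨a, ha, .inl h⟩
    · exact ⟨a, ha, .inr h⟩
  · rintro ⟨a, ha, h | h⟩
    · exact .inl ⟨a, ha, h⟩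
    · exact .inr ⟨a, ha, h⟩

theorem exists_mem_Cc (v : V) : ∃ K ∈ G.Cc, v ∈ K := by
  classical
  refine ⟨Finset.univ.filter fun w => G.und.Reachable v w, ?_, by simp⟩
  exact Finset.mem_image.2 ⟨v, Finset.mem_univ v, by ext; simp⟩

variable {K : Finset V} (hK : K ∈ G.Cc)
include hK

theorem mem_iff_reachable {a b : V} (ha : a ∈ K) : b ∈ K ↔ G.und.Reachable a b := by
  obtain ⟨v, -, rfl⟩ := Finset.mem_image.1 hK
  simp only [Finset.mem_filter, Finset.mem_univ, true_and] at ha ⊢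
  exact ⟨fun h => ha.symm.trans h, fun h => ha.trans h⟩

theorem mem_of_und {a b : V} (ha : a ∈ K) (h : G.und.Adj a b) : b ∈ K :=
  (mem_iff_reachable hK ha).2 h.reachable

theorem eq_of_mem_of_mem {K' : Finset V} (hK' : K' ∈ G.Cc) {a : V} (ha : a ∈ K) (ha' : a ∈ K') :
    K = K' := by
  ext b
  rw [mem_iff_reachable hK ha, mem_iff_reachable hK' ha']

theorem not_strictDescendant_of_mem {d : V} (hd : d ∈ K) : ¬ G.StrictDescendant K d := by
  rintro ⟨k, hk, c, hc, hcd⟩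
  exact G.no_semidirected_cycle k c hc
    (hcd.trans (reflTransGen_of_reachable ((mem_iff_reachable hK hd).1 hk)))

theorem not_strictDescendant_of_mem_Pa {d : V} (hd : d ∈ G.Pa K) : ¬ G.StrictDescendant K d := by
  intro h
  obtain ⟨a, ha, hda⟩ := mem_Pa.1 hd
  exact not_strictDescendant_of_mem hK ha (h.tail (hda.imp_right .inl))

theorem disjoint_Pa : Disjoint K (G.Pa K) := by
  rw [Finset.disjoint_left]
  intro d hd hd'
  obtain ⟨a, ha, hda⟩ := mem_Pa.1 hd'
  exact not_strictDescendant_of_mem hK ha (strictDescendant_of_arrow hd hda)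

theorem not_mem_Mo_of_mem_Fa {d : V} (hd : d ∈ G.Fa K) : d ∉ G.Mo K := by
  intro hd'
  obtain ⟨a, ha, h⟩ := mem_Fa.1 hd
  obtain ⟨b, hb, h'⟩ := mem_Mo.1 hd'
  exact G.fathers_disjoint_mothers d a b ((mem_iff_reachable hK ha).1 hb) h h'

end Families

section Routes

variable {Z : Finset V} {n : ℕ} {r : ℕ → V}

/-- A node that the route leaves backwards through an outgoing arrow is not in `Z`. -/
theorem IsOpen.not_mem_of_arrow (h : G.IsOpen Z n r) {t : ℕ} (ht : t + 1 ≤ n)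
    (ha : G.solid (r (t + 1)) (r t) ∨ G.dashed (r (t + 1)) (r t)) : r (t + 1) ∉ Z := by
  have hu : ¬ G.und.Adj (r (t + 1)) (r t) := fun hu =>
    ha.elim (not_solid_of_und hu) (not_dashed_of_und hu)
  have hs : ¬ G.solid (r t) (r (t + 1)) := fun hs =>
    ha.elim (not_solid_of_solid hs) (not_dashed_symm_of_solid hs)
  have hd : ¬ G.dashed (r t) (r (t + 1)) := fun hd =>
    ha.elim (fun ha => not_dashed_symm_of_solid ha hd) (not_dashed_of_dashed hd)
  refine h.2.2 (t + 1) ht ?_ ?_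
  · rintro ⟨-, -, h1 | h1⟩
    · exact hd h1.1
    · rcases h1.2 with h1 | h1 | h1
      · exact hd h1
      · exact hu h1
      · exact hs h1
  · rintro ⟨j, k, ⟨h1, h2, h3, h4, h5, h6⟩, h7, h8⟩
    rcases h7.eq_or_lt with rfl | h7
    · exact hs h5
    · exact hu (h4 t (by omega) (by omega)).symm

/-- Arrowheads at both ends of an undirected subroute form a collider section if both arrows are
solid, and otherwise make an end with a dashed arrow a collider node. Either case requires a node of
`Z`. -/
theorem IsOpen.not_arrows_of_und (h : G.IsOpen Z n r) {j m : ℕ} (hj : 1 ≤ j) (hjm : j ≤ m)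
    (hm : m + 1 ≤ n) (hu : ∀ i, j ≤ i → i < m → G.und.Adj (r i) (r (i + 1)))
    (hZ : ∀ i, j ≤ i → i ≤ m → r i ∉ Z)
    (h1 : G.solid (r (j - 1)) (r j) ∨ G.dashed (r (j - 1)) (r j)) :
    ¬ (G.solid (r (m + 1)) (r m) ∨ G.dashed (r (m + 1)) (r m)) := by
  intro h2
  by_cases hd : G.dashed (r (j - 1)) (r j)
  · refine hZ j le_rfl hjm (h.1 j ⟨hj, by omega, .inl ⟨hd, ?_⟩⟩)
    rcases hjm.eq_or_lt with rfl | hjm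
    · rcases h2 with h2 | h2
      · exact .inr (.inr h2)
      · exact .inl h2
    · exact .inr (.inl (hu j le_rfl hjm))
  · have hs := h1.resolve_right hd
    rcases h2 with h2 | h2
    · obtain ⟨i, h3, h4, h5⟩ := h.2.1 j m ⟨hj, hjm, hm, hu, hs, h2⟩
      exact hZ i h3 h4 h5
    · refine hZ m hjm le_rfl (h.1 m ⟨by omega, hm, .inr ⟨h2, ?_⟩⟩)
      rcases hjm.eq_or_lt with rfl | hjm
      · exact .inr (.inr hs)
      · have := hu (m - 1) (by omega) (by omega)
        rw [Nat.sub_add_cancel (by omega)] at this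
        exact .inr (.inl this.symm)

/-- A node entered by an undirected edge can be a collider only through a dashed arrow on its other
side. Being preceded by the starting node of the route, it is in no collider section. -/
theorem IsOpen.not_mem_of_und_und (h : G.IsOpen Z n r) (hn : 1 ≤ n) (h0 : G.und.Adj (r 0) (r 1))
    (h1 : 2 ≤ n → ¬ G.dashed (r 2) (r 1)) : r 1 ∉ Z := by
  refine h.2.2 1 hn ?_ ?_
  · rintro ⟨-, h2, h3 | h3⟩
    · exact not_dashed_of_und h0 h3.1
    · exact h1 h2 h3.1
  · rintro ⟨j, k, ⟨h1, h2, h3, h4, h5, h6⟩, h7, h8⟩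
    obtain rfl : j = 1 := by omega
    exact not_solid_of_und h0 h5

variable [Fintype V] [DecidableEq V] {K : Finset V}

/-- An open route that starts in the chain component `K` stays in `K`, or ends in a descendant
of `K`, or leaves `K` through an arrow pointing to `K`. -/
theorem IsOpen.trichotomy (h : G.IsOpen Z n r) (hr : G.IsRoute n r) (hK : K ∈ G.Cc)
    (h0 : r 0 ∈ K) (hZ : ∀ d, G.StrictDescendant K d → d ∉ Z) :
    (∀ s < n, G.und.Adj (r s) (r (s + 1))) ∨ G.StrictDescendant K (r n) ∨
      ∃ t < n, (∀ s < t, G.und.Adj (r s) (r (s + 1))) ∧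
        (G.solid (r (t + 1)) (r t) ∨ G.dashed (r (t + 1)) (r t)) := by
  have hmem : ∀ m, (∀ s < m, G.und.Adj (r s) (r (s + 1))) → r m ∈ K := by
    intro m
    induction m with
    | zero => exact fun _ => h0
    | succ m ih =>
      exact fun hu => mem_of_und hK (ih fun s hs => hu s (by omega)) (hu m (by omega))
  -- For the induction, the descendant case keeps the whole current undirected subroute and the
  -- forward arrow that entered it. These exclude a later backward arrow.
  suffices key : ∀ m ≤ n, (∀ s < m, G.und.Adj (r s) (r (s + 1))) ∨
      (∃ j, 1 ≤ j ∧ j ≤ m ∧ (∀ i, j ≤ i → i ≤ m → G.StrictDescendant K (r i)) ∧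
        (∀ i, j ≤ i → i < m → G.und.Adj (r i) (r (i + 1))) ∧
        (G.solid (r (j - 1)) (r j) ∨ G.dashed (r (j - 1)) (r j))) ∨
      ∃ t < m, (∀ s < t, G.und.Adj (r s) (r (s + 1))) ∧
        (G.solid (r (t + 1)) (r t) ∨ G.dashed (r (t + 1)) (r t)) by
    refine (key n le_rfl).imp_right (Or.imp_left ?_)
    rintro ⟨j, -, h2, h3, -⟩
    exact h3 n h2 le_rfl
  intro m
  induction m with
  | zero => exact fun _ => .inl fun s hs => by omega
  | succ m ih =>
    intro hm
    have hadj : G.und.Adj (r m) (r (m + 1)) ∨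
        (G.solid (r m) (r (m + 1)) ∨ G.dashed (r m) (r (m + 1))) ∨
        (G.solid (r (m + 1)) (r m) ∨ G.dashed (r (m + 1)) (r m)) := by
      rcases hr m (by omega) with h | h | h | h | h
      · exact .inr (.inl (.inl h))
      · exact .inr (.inr (.inl h))
      · exact .inr (.inl (.inr h))
      · exact .inr (.inr (.inr h))
      · exact .inl h
    rcases ih (by omega) with hA | ⟨j, h1, h2, h3, h4, h5⟩ | ⟨t, ht, h1, h2⟩
    · rcases hadj with hu | hf | hb
      · refine .inl fun s hs => ?_
        rcases Nat.lt_succ_iff_lt_or_eq.1 hs with hs | rfl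
        · exact hA s hs
        · exact hu
      · refine .inr (.inl ⟨m + 1, by omega, le_rfl, fun i hi hi' => ?_, fun i hi hi' => by omega,
          by simpa using hf⟩)
        obtain rfl : i = m + 1 := by omega
        exact strictDescendant_of_arrow (hmem m hA) hf
      · exact .inr (.inr ⟨m, by omega, hA, hb⟩)
    · rcases hadj with hu | hf | hb
      · refine .inr (.inl ⟨j, h1, by omega, fun i hi hi' => ?_, fun i hi hi' => ?_, h5⟩)
        · rcases hi'.eq_or_lt with rfl | hi'
          · exact (h3 m h2 le_rfl).tail (.inr (.inr hu))
          · exact h3 i hi (by omega)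
        · rcases Nat.lt_succ_iff_lt_or_eq.1 hi' with hi' | rfl
          · exact h4 i hi hi'
          · exact hu
      · refine .inr (.inl ⟨m + 1, by omega, le_rfl, fun i hi hi' => ?_, fun i hi hi' => by omega,
          by simpa using hf⟩)
        obtain rfl : i = m + 1 := by omega
        exact (h3 m h2 le_rfl).tail (hf.imp_right .inl)
      · exact absurd hb (h.not_arrows_of_und h1 h2 hm h4 (fun i hi hi' => hZ _ (h3 i hi hi')) h5)
    · exact .inr (.inr ⟨t, by omega, h1, h2⟩)

theorem mem_of_forall_und (hK : K ∈ G.Cc) (h0 : r 0 ∈ K) {m : ℕ}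
    (hu : ∀ s < m, G.und.Adj (r s) (r (s + 1))) : r m ∈ K := by
  induction m with
  | zero => exact h0
  | succ m ih => exact mem_of_und hK (ih fun s hs => hu s (by omega)) (hu m (by omega))

/-- A chain component is separated from its nondescendants given its parents. -/
theorem separated_Pa (hK : K ∈ G.Cc) {Y : Finset V}
    (hY : ∀ y ∈ Y, y ∉ K ∧ ¬ G.StrictDescendant K y) : G.Separated K Y (G.Pa K) := by
  rintro ⟨n, r, hr, h0, hn, ho⟩
  obtain ⟨h1, h2⟩ := hY _ hn
  rcases ho.trichotomy hr hK h0 fun d hd hd' => not_strictDescendant_of_mem_Pa hK hd' hd with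
    hA | hB | ⟨t, ht, hu, ha⟩
  · exact h1 (mem_of_forall_und hK h0 hA)
  · exact h2 hB
  · exact ho.not_mem_of_arrow ht ha (mem_Pa.2 ⟨r t, mem_of_forall_und hK h0 hu, ha⟩)

/-- A node of a chain component is separated from the mothers of the other nodes given the other
parents. -/
theorem separated_mother (hK : K ∈ G.Cc) {i j : V} (hi : i ∈ K) (hj : j ∈ G.Mo K)
    (hij : j ∉ G.Mo {i}) : G.Separated {i} {j} (G.Pa K \ {j}) := by
  rintro ⟨n, r, hr, h0, hn, ho⟩
  rw [Finset.mem_singleton] at h0 hn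
  have h0K : r 0 ∈ K := h0 ▸ hi
  have hjPa : j ∈ G.Pa K := Finset.mem_union_right _ hj
  rcases ho.trichotomy hr hK h0K fun d hd hd' =>
    not_strictDescendant_of_mem_Pa hK (Finset.mem_sdiff.1 hd').1 hd with hA | hB | ⟨t, ht, hu, ha⟩
  · have hjK := mem_of_forall_und hK h0K hA
    rw [hn] at hjK
    exact Finset.disjoint_left.1 (disjoint_Pa hK) hjK hjPa
  · rw [hn] at hB
    exact not_strictDescendant_of_mem_Pa hK hjPa hB
  · have htK := mem_of_forall_und hK h0K hu
    have h1 := ho.not_mem_of_arrow ht ha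
    have hPa : r (t + 1) ∈ G.Pa K := mem_Pa.2 ⟨r t, htK, ha⟩
    have hrj : r (t + 1) = j := by
      by_contra hne
      exact h1 (Finset.mem_sdiff.2 ⟨hPa, by simpa using hne⟩)
    rw [hrj] at ha
    have hd : G.dashed j (r t) := ha.resolve_left fun hs =>
      not_mem_Mo_of_mem_Fa hK (mem_Fa.2 ⟨_, htK, hs⟩) hj
    rcases Nat.eq_zero_or_pos t with rfl | ht0
    · rw [h0] at hd
      exact hij (mem_Mo.2 ⟨i, by simp, hd⟩)
    · have hu' := hu (t - 1) (by omega)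
      rw [Nat.sub_add_cancel (by omega)] at hu'
      -- The route reaches `r t` inside `K` by an undirected edge and leaves it against the dashed
      -- arrow from `j`. So `r t` is a collider node and would have to be a parent of `K`.
      have hc := ho.1 t ⟨ht0, ht, .inr ⟨by rwa [hrj], .inr (.inl hu'.symm)⟩⟩
      exact Finset.disjoint_left.1 (disjoint_Pa hK) htK (Finset.mem_sdiff.1 hc).1

/-- Two nonadjacent nodes, one in a chain component and the other in this component or among its
fathers, are separated given the rest of the component and its parents. -/
theorem separated_nonadjacent (hK : K ∈ G.Cc) {i j : V} (hi : i ∈ K) (hj : j ∈ K ∪ G.Pa K)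
    (hne : i ≠ j) (hu : ¬ G.und.Adj i j) (hs : ¬ G.solid j i) (hd : j ∉ G.Mo K) :
    G.Separated {i} {j} ((K ∪ G.Pa K) \ {i, j}) := by
  rintro ⟨n, r, hr, h0, hn, ho⟩
  rw [Finset.mem_singleton] at h0 hn
  have h0K : r 0 ∈ K := h0 ▸ hi
  have hdesc : ∀ d, d ∈ K ∪ G.Pa K → ¬ G.StrictDescendant K d := fun d hd =>
    (Finset.mem_union.1 hd).elim (not_strictDescendant_of_mem hK) (not_strictDescendant_of_mem_Pa hK)
  have hmemZ : ∀ d, d ∈ K ∪ G.Pa K → d ≠ i → d ≠ j → d ∈ (K ∪ G.Pa K) \ {i, j} :=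
    fun d h1 h2 h3 => by simp [Finset.mem_sdiff, h2, h3, Finset.mem_union.1 h1]
  have hn1 : 1 ≤ n := by
    by_contra hn0
    obtain rfl : n = 0 := by omega
    exact hne (h0.symm.trans hn)
  -- The second node lies in `K` and differs from `i` and `j`, hence is in `Z`. It must then be a
  -- collider node, with a dashed arrow next.
  have hfirst : G.und.Adj (r 0) (r 1) → 2 ≤ n ∧ G.dashed (r 2) (r 1) := by
    intro h01
    by_contra hcon
    refine ho.not_mem_of_und_und hn1 h01 (fun h2 h3 => hcon ⟨h2, h3⟩) (hmemZ _ ?_ ?_ ?_)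
    · exact Finset.mem_union_left _ (mem_of_und hK h0K h01)
    · rw [← h0]
      exact h01.ne'
    · rintro h1
      rw [h0, h1] at h01
      exact hu h01
  have hparent : ∀ t < n, r t ∈ K → (G.solid (r (t + 1)) (r t) ∨ G.dashed (r (t + 1)) (r t)) →
      r (t + 1) = j := by
    intro t ht htK ha
    by_contra hne'
    have hPa : r (t + 1) ∈ G.Pa K := mem_Pa.2 ⟨r t, htK, ha⟩
    refine ho.not_mem_of_arrow ht ha (hmemZ _ (Finset.mem_union_right _ hPa) ?_ hne')
    rintro h
    exact Finset.disjoint_left.1 (disjoint_Pa hK) hi (h ▸ hPa)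
  rcases ho.trichotomy hr hK h0K fun d hd hd' => hdesc d (Finset.mem_sdiff.1 hd').1 hd with
    hA | hB | ⟨t, ht, hut, ha⟩
  · obtain ⟨h2, h3⟩ := hfirst (hA 0 hn1)
    exact not_dashed_of_und (hA 1 h2).symm h3
  · rw [hn] at hB
    exact hdesc j hj hB
  · have htj := hparent t ht (mem_of_forall_und hK h0K hut) ha
    rcases Nat.eq_zero_or_pos t with rfl | ht0
    · rw [htj, h0] at ha
      exact ha.elim hs fun ha => hd (mem_Mo.2 ⟨i, hi, ha⟩)
    · obtain ⟨h2, h3⟩ := hfirst (hut 0 ht0)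
      have h1K : r 1 ∈ K := mem_of_und hK h0K (hut 0 ht0)
      have h2j := hparent 1 h2 h1K (.inr h3)
      rw [show 1 + 1 = 2 from rfl] at h2j
      exact hd (mem_Mo.2 ⟨r 1, h1K, h2j ▸ h3⟩)

end Routes

end UCG

/-! ### The matrix of residuals and the conditional precision matrices -/

namespace UCG

open Matrix

variable {V : Type*} [Fintype V] {G : UCG V}

section Component

open Classical in
/-- The chain component of the node `v`. -/
noncomputable def component (G : UCG V) (v : V) : Finset V :=
  Finset.univ.filter fun w => G.und.Reachable v w

theorem mem_component {v w : V} : w ∈ G.component v ↔ G.und.Reachable v w := by simp [component]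

theorem self_mem_component (v : V) : v ∈ G.component v := mem_component.2 (.refl v)

theorem mem_component_comm {v w : V} : w ∈ G.component v ↔ v ∈ G.component w := by
  rw [mem_component, mem_component, SimpleGraph.reachable_comm]

variable [DecidableEq V]

theorem component_mem_Cc (v : V) : G.component v ∈ G.Cc :=
  Finset.mem_image.2 ⟨v, Finset.mem_univ v, by ext; simp [component]⟩

theorem component_eq {K : Finset V} (hK : K ∈ G.Cc) {v : V} (hv : v ∈ K) : G.component v = K :=
  eq_of_mem_of_mem (component_mem_Cc v) hK (self_mem_component v) hv

theorem component_eq_of_mem {v w : V} (h : w ∈ G.component v) : G.component w = G.component v :=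
  component_eq (component_mem_Cc v) h

theorem not_mem_Pa_component (v : V) : v ∉ G.Pa (G.component v) :=
  Finset.disjoint_left.1 (disjoint_Pa (component_mem_Cc v)) (self_mem_component v)

theorem sum_sum_Cc {M : Type*} [AddCommMonoid M] (f : V → M) :
    ∑ K ∈ G.Cc, ∑ i ∈ K, f i = ∑ i, f i := by
  rw [← Finset.sum_biUnion]
  · refine Finset.sum_congr ?_ fun _ _ => rfl
    ext v
    simp only [Finset.mem_biUnion, Finset.mem_univ, iff_true]
    exact exists_mem_Cc v
  · intro K hK K' hK' hne
    exact Finset.disjoint_left.2 fun v hv hv' => hne (eq_of_mem_of_mem hK hK' hv hv')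

end Component

section Ancestors

open Classical in
/-- The number of nodes from which there is a semidirected route to `v`. -/
noncomputable def ancestorCard (G : UCG V) (v : V) : ℕ :=
  (Finset.univ.filter fun u =>
    Relation.ReflTransGen (fun c d => G.solid c d ∨ G.dashed c d ∨ G.und.Adj c d) u v).card

variable [DecidableEq V]

theorem ancestorCard_lt {i j : V} (h : j ∈ G.Pa (G.component i)) :
    G.ancestorCard j < G.ancestorCard i := by
  obtain ⟨c, hc, hjc⟩ := mem_Pa.1 h
  have hci := reflTransGen_of_reachable (mem_component.1 hc).symm
  have hji : Relation.ReflTransGen (fun c d => G.solid c d ∨ G.dashed c d ∨ G.und.Adj c d) j i :=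
    .head (hjc.elim .inl fun h => .inr (.inl h)) hci
  refine Finset.card_lt_card ⟨fun u hu => ?_, fun hsub => ?_⟩
  · simp only [Finset.mem_filter, Finset.mem_univ, true_and] at hu ⊢
    exact hu.trans hji
  · have := hsub (x := i) (by simp only [Finset.mem_filter, Finset.mem_univ, true_and]; exact .refl)
    simp only [Finset.mem_filter, Finset.mem_univ, true_and] at this
    exact G.no_semidirected_cycle j c hjc (hci.trans this)

end Ancestors

section ResidualMatrix

variable [DecidableEq V] {S R : Matrix V V ℝ}
  (hR : ∀ i, IsResidual S (G.Pa (G.component i)) i (R i))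

include hR

/-- Parents of a component have strictly fewer ancestors than its nodes, so ordering by
`ancestorCard` makes `Rᵀ` block triangular with identity diagonal blocks. -/
theorem det_residualMatrix : R.det = 1 := by
  have hb : Rᵀ.BlockTriangular G.ancestorCard := fun i j hij =>
    (hR j).apply_eq_zero i (fun h => hij.ne (by rw [h])) fun h => (ancestorCard_lt h).not_gt hij
  rw [← det_transpose, hb.det]
  refine Finset.prod_eq_one fun n _ => ?_
  have : Rᵀ.toSquareBlock G.ancestorCard n = 1 := by
    ext ⟨i, hi⟩ ⟨j, hj⟩
    change R j i = _
    by_cases hij : i = j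
    · subst hij
      rw [one_apply_eq, (hR i).apply_self]
    · rw [one_apply_ne (by simpa using hij),
        (hR j).apply_eq_zero i hij fun h => (ancestorCard_lt h).ne (hi.trans hj.symm)]
  rw [this, det_one]

/-- Nodes of one component have the same set of conditioning parents. The residual of `j` is
uncorrelated with these, so of the residual of `i` only the coordinate `i` contributes. -/
theorem mul_mul_transpose_apply {i j : V} (hj : j ∈ G.component i) :
    (R * S * Rᵀ) i j = (S *ᵥ R j) i := by
  have h : (R * S * Rᵀ) i j = R i ⬝ᵥ S *ᵥ R j := by
    rw [Matrix.mul_assoc, mul_apply_eq_vecMul, ← mul_apply_eq_vecMul]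
    rfl
  rw [h, dotProduct, Finset.sum_eq_single i, (hR i).apply_self, one_mul]
  · intro v _ hv
    by_cases hvP : v ∈ G.Pa (G.component i)
    · rw [(hR j).mulVec_eq_zero v (by rwa [component_eq_of_mem hj]), mul_zero]
    · rw [(hR i).apply_eq_zero v hv hvP, zero_mul]
  · simp

theorem posDef_mul_mul_transpose (hS : S.PosDef) : (R * S * Rᵀ).PosDef := by
  have h : IsUnit R := (isUnit_iff_isUnit_det R).2 (by rw [det_residualMatrix hR]; exact isUnit_one)
  have := hS.mul_mul_conjTranspose_same (B := R) (vecMul_injective_iff_isUnit.2 h)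
  rwa [conjTranspose_eq_transpose_of_trivial] at this

end ResidualMatrix

section Regression

variable [DecidableEq V] {p : Measure (V → ℝ)} {R : Matrix V V ℝ}

theorem _root_.IsResidual.condCov_eq (hp : (covMat p).PosDef) {K P : Finset V} (i j : K)
    {a : V → ℝ} (ha : IsResidual (covMat p) P i a) (hi : (i : V) ∉ P) :
    condCov p K P i j = (covMat p *ᵥ a) j := by
  have hsymm : ∀ k l, covMat p k l = covMat p l k := fun k l => by
    conv_lhs => rw [← covMat_transpose p]
    rfl
  have h : condCov p K P = covBlock p K K - regCoef p K P * covBlock p P K := rfl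
  rw [h, Matrix.sub_apply, mul_apply, mulVec, dotProduct, sum_eq_add_sum_of_support hi fun v h1 h2 => by
    rw [ha.apply_eq_zero v h1 h2, mul_zero], ha.apply_self, mul_one, sub_eq_add_neg,
    ← Finset.sum_neg_distrib]
  congr 1
  · exact hsymm _ _
  · refine Finset.sum_congr rfl fun z _ => ?_
    rw [ha.regCoef_eq hp i z hi, neg_mul, neg_neg, mul_comm, hsymm]
    rfl

variable (hp : (covMat p).PosDef)
  (hR : ∀ i, IsResidual (covMat p) (G.Pa (G.component i)) i (R i))

/-- The block diagonal matrix whose blocks are the inverses of the conditional covariance matrices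
of the chain components given their parents. -/
noncomputable def condPrecision (G : UCG V) (p : Measure (V → ℝ)) : Matrix V V ℝ :=
  of fun i j => if h : j ∈ G.component i then
    (condCov p (G.component i) (G.Pa (G.component i)))⁻¹ ⟨i, self_mem_component i⟩ ⟨j, h⟩ else 0

theorem condPrecision_apply {K : Finset V} (hK : K ∈ G.Cc) (i j : K) :
    condPrecision G p i j = (condCov p K (G.Pa K))⁻¹ i j := by
  obtain ⟨i, hi⟩ := i
  obtain rfl := component_eq hK hi
  exact dif_pos j.2

theorem condPrecision_eq_zero {i j : V} (h : j ∉ G.component i) : condPrecision G p i j = 0 :=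
  dif_neg h

include hp hR

theorem condCov_eq_submatrix {K : Finset V} (hK : K ∈ G.Cc) :
    condCov p K (G.Pa K) = (R * covMat p * Rᵀ).submatrix (fun i : K => (i : V)) fun i : K => (i : V) := by
  ext i j
  have hi := component_eq hK i.2
  rw [submatrix_apply, ← transpose_apply (R * covMat p * Rᵀ), transpose_mul, transpose_mul,
    transpose_transpose, covMat_transpose, ← Matrix.mul_assoc,
    mul_mul_transpose_apply hR (by rw [component_eq hK j.2]; exact i.2)]
  have h := hR i
  rw [hi] at h
  exact h.condCov_eq hp i j (Finset.disjoint_left.1 (disjoint_Pa hK) i.2)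

theorem posDef_condCov {K : Finset V} (hK : K ∈ G.Cc) : (condCov p K (G.Pa K)).PosDef := by
  rw [condCov_eq_submatrix hp hR hK]
  exact (posDef_mul_mul_transpose hR hp).submatrix Subtype.val_injective

theorem sum_mul_condPrecision {i j : V} {f : V → ℝ}
    (hf : ∀ k ∈ G.component i, f k = (R * covMat p * Rᵀ) i k) (hj : j ∈ G.component i) :
    ∑ k ∈ G.component i, f k * condPrecision G p k j = (1 : Matrix V V ℝ) i j := by
  have hK := component_mem_Cc (G := G) i
  have hu : IsUnit (condCov p (G.component i) (G.Pa (G.component i))).det :=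
    (posDef_condCov hp hR hK).det_pos.ne'.isUnit
  have h := congrFun (congrFun (mul_nonsing_inv _ hu) ⟨i, self_mem_component i⟩) ⟨j, hj⟩
  rw [← Finset.sum_coe_sort]
  refine Eq.trans ?_ (h.trans ?_)
  · rw [mul_apply]
    refine Finset.sum_congr rfl fun k _ => ?_
    rw [condPrecision_apply hK k ⟨j, hj⟩, hf k k.2, condCov_eq_submatrix hp hR hK]
    rfl
  · simp [one_apply]

theorem mul_condPrecision {D : Matrix V V ℝ}
    (hD : ∀ i, ∀ j ∈ G.component i, D i j = (R * covMat p * Rᵀ) i j)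
    (hD0 : ∀ i, ∀ j ∉ G.component i, D i j = 0) : D * condPrecision G p = 1 := by
  ext i j
  rw [mul_apply]
  by_cases hj : j ∈ G.component i
  · rw [← sum_mul_condPrecision hp hR (hD i) hj]
    refine (Finset.sum_subset (Finset.subset_univ _) fun k _ hk => ?_).symm
    rw [hD0 i k hk, zero_mul]
  · rw [one_apply_ne fun h : i = j => hj (h ▸ self_mem_component i)]
    refine Finset.sum_eq_zero fun k _ => ?_
    by_cases hk : k ∈ G.component i
    · rw [condPrecision_eq_zero (by rwa [component_eq_of_mem hk]), mul_zero]
    · rw [hD0 i k hk, zero_mul]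

theorem condPrecision_transpose : (condPrecision G p)ᵀ = condPrecision G p := by
  ext i j
  rw [transpose_apply]
  by_cases hj : j ∈ G.component i
  · have hK := component_mem_Cc (G := G) i
    rw [condPrecision_apply hK ⟨j, hj⟩ ⟨i, self_mem_component i⟩,
      condPrecision_apply hK ⟨i, self_mem_component i⟩ ⟨j, hj⟩]
    have := (posDef_condCov hp hR hK).inv.isHermitian.apply ⟨i, self_mem_component i⟩ ⟨j, hj⟩
    simpa using this
  · rw [condPrecision_eq_zero hj, condPrecision_eq_zero fun h => hj (mem_component_comm.1 h)]

/-- With `M` the conditional precision matrix, row `i` of `M R` is supported on `A`. Multiplied by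
`Σ`, it gives the unit row on `A`: on `K` because `M` inverts the conditional covariance, on the
parents because residuals are orthogonal to them. -/
theorem margPrecision_apply {K A : Finset V} (hK : K ∈ G.Cc) (hA : A = K ∪ G.Pa K) (i j : A)
    (hi : (i : V) ∈ K) : margPrecision p A i j = (condPrecision G p * R) i j := by
  have hu : IsUnit (covBlock p A A).det :=
    (hp.submatrix Subtype.val_injective : (covBlock p A A).PosDef).det_pos.ne'.isUnit
  have hcomp := component_eq hK hi
  have hsymm : ∀ k l, covMat p k l = covMat p l k := fun k l => by
    conv_lhs => rw [← covMat_transpose p]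
    rfl
  have hMsymm : ∀ k l, condPrecision G p k l = condPrecision G p l k := fun k l => by
    conv_lhs => rw [← condPrecision_transpose hp hR]
    rfl
  have hW : ∀ v, (condPrecision G p * R) i v = ∑ k ∈ K, condPrecision G p i k * R k v := fun v => by
    rw [mul_apply]
    refine (Finset.sum_subset (Finset.subset_univ _) fun k _ hk => ?_).symm
    rw [condPrecision_eq_zero (by rwa [hcomp]), zero_mul]
  have hsupp : ∀ v ∉ A, (condPrecision G p * R) i v = 0 := fun v hv => by
    rw [hA, Finset.mem_union, not_or] at hv
    rw [hW]
    refine Finset.sum_eq_zero fun k hk => ?_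
    rw [(hR k).apply_eq_zero v (fun h => hv.1 (h ▸ hk)) (by rw [component_eq hK hk]; exact hv.2),
      mul_zero]
  have hSW : ∀ v ∈ A, ((condPrecision G p * R) * covMat p) i v = (1 : Matrix V V ℝ) i v := by
    intro v hv
    have h1 : ((condPrecision G p * R) * covMat p) i v
        = ∑ k ∈ K, (covMat p *ᵥ R k) v * condPrecision G p k i := by
      rw [mul_apply]
      simp only [hW, Finset.sum_mul, mulVec, dotProduct]
      rw [Finset.sum_comm]
      refine Finset.sum_congr rfl fun k _ => Finset.sum_congr rfl fun u _ => ?_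
      rw [hMsymm k i, hsymm v u]
      ring
    rw [h1]
    by_cases hvK : v ∈ K
    · have hv' := component_eq hK hvK
      have := sum_mul_condPrecision hp hR (i := v) (j := i) (f := fun k => (covMat p *ᵥ R k) v)
        (fun k hk => (mul_mul_transpose_apply hR hk).symm) (by rwa [hv'])
      rw [hv'] at this
      rw [this, one_apply, one_apply]
      simp only [eq_comm]
    · have hvP : v ∈ G.Pa K := (Finset.mem_union.1 (hA ▸ hv)).resolve_left hvK
      rw [one_apply_ne fun h : i = v => hvK (h ▸ hi)]
      refine Finset.sum_eq_zero fun k hk => ?_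
      rw [(hR k).mulVec_eq_zero v (by rwa [component_eq hK hk]), zero_mul]
  have hkey : (fun v : A => (condPrecision G p * R) i v) ᵥ* covBlock p A A
      = (1 : Matrix A A ℝ) i := by
    ext v
    have h2 := hSW v v.2
    rw [mul_apply, ← Finset.sum_subset (Finset.subset_univ A) fun u _ hu => by
      rw [hsupp u hu, zero_mul], ← Finset.sum_coe_sort] at h2
    refine Eq.trans h2 ?_
    simp [one_apply]
  have h3 := congrArg (fun w => (w ᵥ* margPrecision p A) j) hkey
  simp only [margPrecision, vecMul_vecMul, mul_nonsing_inv _ hu, vecMul_one] at h3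
  rw [h3]
  simp [vecMul, dotProduct, one_apply, margPrecision]

end Regression

end UCG

/-! ### Marginal and conditional Gaussian densities -/

section GaussianMarginals

open Matrix

variable {ι κ : Type*} [Fintype ι] [Fintype κ] [DecidableEq ι] [DecidableEq κ]

theorem gaussianDensity_comp_equiv (e : κ ≃ ι) (m : ι → ℝ) (S : Matrix ι ι ℝ) (x : ι → ℝ) :
    gaussianDensity (m ∘ e) (S.submatrix e e) (x ∘ e) = gaussianDensity m S x := by
  have h : x ∘ e - m ∘ e = (x - m) ∘ e := rfl
  rw [gaussianDensity, gaussianDensity, Fintype.card_congr e, det_submatrix_equiv_self,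
    inv_submatrix_equiv, h, submatrix_mulVec_equiv, Function.comp_assoc, Equiv.self_comp_symm,
    Function.comp_id, comp_equiv_dotProduct_comp_equiv]

/-- Completion of the square, read off from the Schur complement formula for the inverse of a block
matrix. -/
theorem dotProduct_inv_fromBlocks_mulVec {A : Matrix ι ι ℝ} {B : Matrix ι κ ℝ} {D : Matrix κ κ ℝ}
    (hD : IsUnit D) (hDs : Dᵀ = D) (hL : IsUnit (A - B * D⁻¹ * Bᵀ)) (x : ι → ℝ) (y : κ → ℝ) :
    Sum.elim x y ⬝ᵥ (fromBlocks A B Bᵀ D)⁻¹ *ᵥ Sum.elim x y =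
      (x - (B * D⁻¹) *ᵥ y) ⬝ᵥ (A - B * D⁻¹ * Bᵀ)⁻¹ *ᵥ (x - (B * D⁻¹) *ᵥ y) + y ⬝ᵥ D⁻¹ *ᵥ y := by
  obtain ⟨_⟩ := hD.nonempty_invertible
  obtain ⟨_⟩ := hL.nonempty_invertible
  let _ : Invertible (A - B * ⅟D * Bᵀ) := by
    rw [invOf_eq_nonsing_inv]; assumption
  let _ := fromBlocks₂₂Invertible A B Bᵀ D
  have hinv := invOf_fromBlocks₂₂_eq A B Bᵀ D
  simp only [invOf_eq_nonsing_inv] at hinv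
  set L := (A - B * D⁻¹ * Bᵀ)⁻¹
  have h1 : D⁻¹ * Bᵀ = (B * D⁻¹)ᵀ := by rw [transpose_mul, transpose_nonsing_inv, hDs]
  rw [hinv, fromBlocks_mulVec, sumElim_dotProduct_sumElim, h1]
  simp only [Sum.elim_comp_inl, Sum.elim_comp_inr, Matrix.mul_assoc L B]
  rw [Matrix.mul_assoc (_ * L), Matrix.mul_assoc _ L]
  set β := B * D⁻¹
  simp only [neg_mulVec, add_mulVec, ← mulVec_mulVec, dotProduct_add, dotProduct_neg, mulVec_sub,
    dotProduct_sub, sub_dotProduct]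
  have h2 : ∀ z, y ⬝ᵥ βᵀ *ᵥ z = (β *ᵥ y) ⬝ᵥ z := fun z => by
    rw [dotProduct_mulVec, vecMul_transpose]
  simp only [h2]
  ring

theorem gaussianDensity_fromBlocks {A : Matrix ι ι ℝ} {B : Matrix ι κ ℝ} {D : Matrix κ κ ℝ}
    (hD : D.PosDef) (hL : (A - B * D⁻¹ * Bᵀ).PosDef) (m x : ι ⊕ κ → ℝ) :
    gaussianDensity m (fromBlocks A B Bᵀ D) x =
      gaussianDensity 0 (A - B * D⁻¹ * Bᵀ)
        ((x - m) ∘ Sum.inl - (B * D⁻¹) *ᵥ ((x - m) ∘ Sum.inr)) *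
      gaussianDensity (m ∘ Sum.inr) D (x ∘ Sum.inr) := by
  have hDs : Dᵀ = D := by rw [← conjTranspose_eq_transpose_of_trivial]; exact hD.isHermitian
  have hdet : (fromBlocks A B Bᵀ D).det = D.det * (A - B * D⁻¹ * Bᵀ).det := by
    obtain ⟨_⟩ := hD.isUnit.nonempty_invertible
    rw [det_fromBlocks₂₂, invOf_eq_nonsing_inv]
  have hq := dotProduct_inv_fromBlocks_mulVec hD.isUnit hDs hL.isUnit ((x - m) ∘ Sum.inl)
    ((x - m) ∘ Sum.inr)
  rw [Sum.elim_comp_inl_inr] at hq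
  have h : x ∘ Sum.inr - m ∘ Sum.inr = (x - m) ∘ Sum.inr := rfl
  simp only [gaussianDensity, hdet, hq, Real.sqrt_mul hD.det_pos.le, Fintype.card_sum, pow_add,
    sub_zero, h, neg_add, add_div, Real.exp_add, mul_inv]
  ring

end GaussianMarginals

section MarginalDensity

open Matrix

variable {V : Type*}

theorem covMat_map_restrict (p : Measure (V → ℝ)) (A : Finset V) :
    covMat (p.map (A.restrict (π := fun _ : V => ℝ))) = covBlock p A A := by
  ext i j
  exact covariance_map (measurable_pi_apply i).aestronglyMeasurable
    (measurable_pi_apply j).aestronglyMeasurable (Finset.measurable_restrict A).aemeasurable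

theorem integral_map_restrict (p : Measure (V → ℝ)) (A : Finset V) (i : A) :
    ∫ y, y i ∂p.map (A.restrict (π := fun _ : V => ℝ)) = ∫ y, y i ∂p :=
  integral_map (Finset.measurable_restrict A).aemeasurable
    (measurable_pi_apply i).aestronglyMeasurable

variable [Fintype V] (p : Measure (V → ℝ)) [IsGaussian p]

instance isGaussian_map_restrict (A : Finset V) :
    IsGaussian (p.map (A.restrict (π := fun _ : V => ℝ))) := by
  let L : (V → ℝ) →L[ℝ] (A → ℝ) := .pi fun i : A => .proj (i : V)
  exact isGaussian_map (μ := p) L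

/-- Needed to pull back almost everywhere identities between marginal densities to the full space.
Restriction does not preserve the measure, but preimages of null sets are null. -/
theorem quasiMeasurePreserving_restrict (A : Finset V) :
    Measure.QuasiMeasurePreserving (A.restrict (π := fun _ : V => ℝ)) volume volume := by
  classical
  convert Measure.quasiMeasurePreserving_fst.comp
    (volume_preserving_piEquivPiSubtypeProd (fun _ : V => ℝ) (· ∈ A)).quasiMeasurePreserving
  · rfl
  · rfl

theorem rnDeriv_eq_gaussianDensity {ι : Type*} [Fintype ι] [DecidableEq ι] (ν : Measure (ι → ℝ))
    [IsGaussian ν] (hν : (covMat ν).PosDef) :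
    ν.rnDeriv volume =ᵐ[volume] fun x =>
      ENNReal.ofReal (gaussianDensity (fun i => ∫ y, y i ∂ν) (covMat ν) x) := by
  conv_lhs => rw [isGaussian_eq_withDensity ν hν]
  exact Measure.rnDeriv_withDensity _
    (ENNReal.measurable_ofReal.comp (continuous_gaussianDensity _ _).measurable)

variable [DecidableEq V]

theorem margDensity_eq_gaussianDensity (hp : (covMat p).PosDef) (A : Finset V) :
    margDensity p A =ᵐ[volume] fun x =>
      ENNReal.ofReal (gaussianDensity (fun i : A => ∫ y, y i ∂p) (covBlock p A A)
        (A.restrict x)) := by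
  have hA : (covMat (p.map (A.restrict (π := fun _ : V => ℝ)))).PosDef := by
    rw [covMat_map_restrict]
    exact hp.submatrix Subtype.val_injective
  have h := (quasiMeasurePreserving_restrict A).ae_eq_comp (rnDeriv_eq_gaussianDensity _ hA)
  rw [covMat_map_restrict] at h
  simp only [integral_map_restrict] at h
  exact h

theorem condDensity_eq_gaussianDensity (hp : (covMat p).PosDef) {K P : Finset V}
    (hKP : Disjoint K P) (hL : (condCov p K P).PosDef) :
    condDensity p K P =ᵐ[volume] fun x =>
      ENNReal.ofReal (gaussianDensity 0 (condCov p K P)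
        ((fun i : K => x i - ∫ y, y i ∂p) -
          regCoef p K P *ᵥ fun i : P => x i - ∫ y, y i ∂p)) := by
  have hP : (covBlock p P P).PosDef := hp.submatrix Subtype.val_injective
  filter_upwards [margDensity_eq_gaussianDensity p hp (K ∪ P),
    margDensity_eq_gaussianDensity p hp P] with x h1 h2
  rw [condDensity, h1, h2, ← ENNReal.ofReal_div_of_pos (gaussianDensity_pos _ hP _)]
  congr 1
  rw [div_eq_iff (gaussianDensity_pos _ hP _).ne',
    ← gaussianDensity_comp_equiv (Equiv.Finset.union K P hKP)]
  have hT : covBlock p P K = (covBlock p K P)ᵀ := by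
    conv_lhs => rw [covBlock, ← covMat_transpose p]
    rfl
  have hB : (covBlock p (K ∪ P) (K ∪ P)).submatrix (Equiv.Finset.union K P hKP)
      (Equiv.Finset.union K P hKP) =
      fromBlocks (covBlock p K K) (covBlock p K P) (covBlock p K P)ᵀ (covBlock p P P) := by
    rw [← hT]
    ext i j
    cases i <;> cases j <;> rfl
  rw [condCov, hT] at hL ⊢
  rw [hB, gaussianDensity_fromBlocks hP hL]
  rfl

end MarginalDensity

/-! ### The factorization as a matrix identity -/

section SymmetricMatrix

open Matrix

theorem Matrix.eq_zero_of_dotProduct_mulVec_self {ι : Type*} [Fintype ι] [DecidableEq ι]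
    {X : Matrix ι ι ℝ} (hX : Xᵀ = X) (h : ∀ z, z ⬝ᵥ X *ᵥ z = 0) : X = 0 := by
  have h1 : ∀ u v : ι → ℝ, u ⬝ᵥ X *ᵥ v = 0 := fun u v => by
    have h2 := h (u + v)
    have h3 : v ⬝ᵥ X *ᵥ u = u ⬝ᵥ X *ᵥ v := by
      rw [dotProduct_mulVec, ← mulVec_transpose, hX, dotProduct_comm]
    simp only [mulVec_add, dotProduct_add, add_dotProduct, h, h3] at h2
    linarith
  ext i j
  simpa using h1 (Pi.single i 1) (Pi.single j 1)

theorem gaussianDensity_eq_mul_exp {ι : Type*} [Fintype ι] [DecidableEq ι] (m : ι → ℝ)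
    (S : Matrix ι ι ℝ) (x : ι → ℝ) :
    gaussianDensity m S x =
      gaussianDensity 0 S 0 * Real.exp (-((x - m) ⬝ᵥ S⁻¹ *ᵥ (x - m)) / 2) := by
  simp [gaussianDensity]

end SymmetricMatrix

namespace UCG

open Matrix

variable {V : Type*} [Fintype V] [DecidableEq V] {G : UCG V} {p : Measure (V → ℝ)}
  {R : Matrix V V ℝ}

theorem _root_.IsResidual.dotProduct_eq (hp : (covMat p).PosDef) {K P : Finset V} (i : K)
    {a : V → ℝ} (ha : IsResidual (covMat p) P i a) (hi : (i : V) ∉ P) (z : V → ℝ) :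
    a ⬝ᵥ z = z i - (regCoef p K P *ᵥ fun j : P => z j) i := by
  rw [dotProduct, sum_eq_add_sum_of_support hi fun v h1 h2 => by
    rw [ha.apply_eq_zero v h1 h2, zero_mul], ha.apply_self, one_mul, sub_eq_add_neg, mulVec,
    dotProduct, ← Finset.sum_neg_distrib]
  congr 1
  refine Finset.sum_congr rfl fun j _ => ?_
  rw [ha.regCoef_eq hp i j hi, neg_mul, neg_neg]

theorem sum_dotProduct_condCov_inv (y : V → ℝ) :
    ∑ K ∈ G.Cc, (fun i : K => y i) ⬝ᵥ (condCov p K (G.Pa K))⁻¹ *ᵥ (fun i : K => y i) =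
      y ⬝ᵥ condPrecision G p *ᵥ y := by
  refine Eq.trans ?_ (sum_sum_Cc (G := G) fun i => y i * (condPrecision G p *ᵥ y) i)
  refine Finset.sum_congr rfl fun K hK => ?_
  refine Eq.trans ?_ (Finset.sum_coe_sort K _)
  refine Finset.sum_congr rfl fun i _ => ?_
  congr 1
  refine Eq.trans (Eq.trans ?_ (Finset.sum_coe_sort K fun j => condPrecision G p i j * y j))
    (Finset.sum_subset (Finset.subset_univ K) fun j _ hj => ?_)
  · refine Finset.sum_congr rfl fun j _ => ?_
    rw [condPrecision_apply hK]
  · rw [condPrecision_eq_zero (by rwa [component_eq hK i.2]), zero_mul]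

theorem prod_gaussianDensity (y : V → ℝ) :
    ∏ K ∈ G.Cc, gaussianDensity 0 (condCov p K (G.Pa K)) (fun i : K => y i) =
      (∏ K ∈ G.Cc, gaussianDensity 0 (condCov p K (G.Pa K)) 0) *
        Real.exp (-(y ⬝ᵥ condPrecision G p *ᵥ y) / 2) := by
  rw [← sum_dotProduct_condCov_inv, ← Finset.sum_neg_distrib, Finset.sum_div, Real.exp_sum,
    ← Finset.prod_mul_distrib]
  refine Finset.prod_congr rfl fun K _ => ?_
  rw [gaussianDensity_eq_mul_exp, sub_zero]

variable (hp : (covMat p).PosDef)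
  (hR : ∀ i, IsResidual (covMat p) (G.Pa (G.component i)) i (R i))

include hp hR

theorem det_covMat_eq_prod (hD : ∀ i j, j ∉ G.component i → (R * covMat p * Rᵀ) i j = 0) :
    (covMat p).det = ∏ K ∈ G.Cc, (condCov p K (G.Pa K)).det := by
  have h1 : (R * covMat p * Rᵀ).det = (covMat p).det := by
    rw [det_mul, det_mul, det_transpose, det_residualMatrix hR, one_mul, mul_one]
  -- The determinant formula needs linearly ordered block labels. Any numbering of the components
  -- serves, since the matrix is block diagonal.
  let e := Fintype.equivFin (Finset V)
  have hb : (R * covMat p * Rᵀ).BlockTriangular (e ∘ G.component) := fun i j hij =>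
    hD i j fun h => hij.ne (by simp [component_eq_of_mem h])
  have himage : Finset.univ.image (e ∘ G.component) = G.Cc.image e := by
    rw [← Finset.image_image]
    congr 1
    ext K
    simp only [Finset.mem_image, Finset.mem_univ, true_and]
    constructor
    · rintro ⟨v, rfl⟩
      exact component_mem_Cc v
    · intro hK
      obtain ⟨v, -, rfl⟩ := Finset.mem_image.1 hK
      exact ⟨v, by ext; simp [component]⟩
  rw [← h1, hb.det, himage, Finset.prod_image fun _ _ _ _ h => e.injective h]
  refine Finset.prod_congr rfl fun K hK => ?_
  have hiff : ∀ i, i ∈ K ↔ (e ∘ G.component) i = e K := fun i => by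
    rw [Function.comp_apply, e.injective.eq_iff]
    exact ⟨component_eq hK, fun h => h ▸ self_mem_component i⟩
  rw [condCov_eq_submatrix hp hR hK, ← det_submatrix_equiv_self (Equiv.subtypeEquivRight hiff)]
  rfl

theorem gaussianDensity_zero_eq_prod
    (hD : ∀ i j, j ∉ G.component i → (R * covMat p * Rᵀ) i j = 0) :
    gaussianDensity 0 (covMat p) 0 = ∏ K ∈ G.Cc, gaussianDensity 0 (condCov p K (G.Pa K)) 0 := by
  have hcard : Fintype.card V = ∑ K ∈ G.Cc, Fintype.card K := by
    simp only [Fintype.card_coe, Finset.card_eq_sum_ones, sum_sum_Cc]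
    simp
  have hsqrt : ∀ s : Finset (Finset V), s ⊆ G.Cc →
      √(∏ K ∈ s, (condCov p K (G.Pa K)).det) = ∏ K ∈ s, √(condCov p K (G.Pa K)).det := by
    intro s hs
    exact Real.sqrt_prod _ fun K hK => (posDef_condCov hp hR (hs hK)).det_pos.le
  simp [gaussianDensity, det_covMat_eq_prod hp hR hD, hcard, Finset.prod_mul_distrib,
    Finset.prod_pow_eq_pow_sum, hsqrt _ subset_rfl]

/-- With `M` the conditional precision matrix, `Σ⁻¹ = Rᵀ M R` means that `R Σ Rᵀ` is the inverse of
`M`. That inverse is always the block diagonal part of `R Σ Rᵀ`. -/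
theorem covMat_inv_eq_iff :
    (covMat p)⁻¹ = Rᵀ * condPrecision G p * R ↔
      ∀ i j, j ∉ G.component i → (R * covMat p * Rᵀ) i j = 0 := by
  have hu : IsUnit (covMat p).det := hp.det_pos.ne'.isUnit
  constructor
  · intro h
    -- The block diagonal part of `R Σ Rᵀ`, which inverts `condPrecision` in any case.
    let D : Matrix V V ℝ := of fun i j => if j ∈ G.component i then (R * covMat p * Rᵀ) i j else 0
    have hDM : D * condPrecision G p = 1 :=
      mul_condPrecision hp hR (fun i j hj => if_pos hj) fun i j hj => if_neg hj
    have h1 : Rᵀ * (condPrecision G p * R * covMat p) = 1 := by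
      rw [← Matrix.mul_assoc, ← Matrix.mul_assoc, ← h, nonsing_inv_mul _ hu]
    have h2 : condPrecision G p * (R * covMat p * Rᵀ) = 1 := by
      rw [← mul_eq_one_comm.1 h1]
      simp only [Matrix.mul_assoc]
    have h3 : R * covMat p * Rᵀ = D := by
      rw [← Matrix.one_mul (R * covMat p * Rᵀ), ← hDM, Matrix.mul_assoc, h2, Matrix.mul_one]
    intro i j hj
    rw [h3]
    exact if_neg hj
  · intro hD
    have h1 := mul_condPrecision hp hR (fun _ _ _ => rfl) hD
    refine inv_eq_left_inv ?_
    refine mul_eq_one_comm.1 ?_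
    have hRu : IsUnit R.det := by rw [det_residualMatrix hR]; exact isUnit_one
    have h2 : R * (covMat p * (Rᵀ * condPrecision G p)) = 1 := by
      rw [← h1]
      simp only [Matrix.mul_assoc]
    rw [← mul_eq_one_comm.1 h2]
    simp only [Matrix.mul_assoc]

/-- Both sides are constants times exponentials of quadratic forms in `x - m`, with matrices `Σ⁻¹`
and `Rᵀ M R`, where `M` is `condPrecision G p`. Equality of the functions is equality of the forms;
the constants then agree because `det R = 1`. -/
theorem factorizes_iff [IsGaussian p] :
    Factorizes p G ↔ ∀ i j, j ∉ G.component i → (R * covMat p * Rᵀ) i j = 0 := by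
  set m : V → ℝ := fun i => ∫ y, y i ∂p with hm
  have hcond : ∀ K ∈ G.Cc, condDensity p K (G.Pa K) =ᵐ[volume] fun x => ENNReal.ofReal
      (gaussianDensity 0 (condCov p K (G.Pa K)) fun i : K => (R *ᵥ (x - m)) i) := by
    intro K hK
    filter_upwards [condDensity_eq_gaussianDensity p hp (disjoint_Pa hK)
      (posDef_condCov hp hR hK)] with x hx
    rw [hx]
    congr 2
    ext i
    have h := hR i
    rw [component_eq hK i.2] at h
    exact (h.dotProduct_eq hp i (Finset.disjoint_left.1 (disjoint_Pa hK) i.2) (x - m)).symm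
  have hprod : (fun x => ∏ K ∈ G.Cc, condDensity p K (G.Pa K) x) =ᵐ[volume] fun x =>
      ENNReal.ofReal ((∏ K ∈ G.Cc, gaussianDensity 0 (condCov p K (G.Pa K)) 0) *
        Real.exp (-((R *ᵥ (x - m)) ⬝ᵥ condPrecision G p *ᵥ (R *ᵥ (x - m))) / 2)) := by
    filter_upwards [(Filter.eventually_all_finset G.Cc).2 hcond] with x hx
    rw [Finset.prod_congr rfl hx, ← prod_gaussianDensity, ENNReal.ofReal_prod_of_nonneg]
    exact fun K hK => (gaussianDensity_pos _ (posDef_condCov hp hR hK) _).le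
  have hleft := rnDeriv_eq_gaussianDensity p hp
  have hc : 0 < ∏ K ∈ G.Cc, gaussianDensity 0 (condCov p K (G.Pa K)) 0 :=
    Finset.prod_pos fun K hK => gaussianDensity_pos _ (posDef_condCov hp hR hK) _
  have hquad : ∀ z : V → ℝ, (R *ᵥ z) ⬝ᵥ condPrecision G p *ᵥ (R *ᵥ z) =
      z ⬝ᵥ (Rᵀ * condPrecision G p * R) *ᵥ z := fun z => by
    rw [← mulVec_mulVec, ← mulVec_mulVec, dotProduct_mulVec z Rᵀ, vecMul_transpose]
  rw [← covMat_inv_eq_iff hp hR]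
  constructor
  · intro h
    have h1 := (hleft.symm.trans h).trans hprod
    -- Continuous functions equal almost everywhere are equal, which permits evaluation at single
    -- points.
    have h2 := Continuous.ae_eq_iff_eq volume
      (ENNReal.continuous_ofReal.comp (continuous_gaussianDensity m (covMat p)))
      (ENNReal.continuous_ofReal.comp (by fun_prop)) |>.1 h1
    have h3 : ∀ z : V → ℝ, gaussianDensity 0 (covMat p) 0 *
        Real.exp (-(z ⬝ᵥ (covMat p)⁻¹ *ᵥ z) / 2) =
        (∏ K ∈ G.Cc, gaussianDensity 0 (condCov p K (G.Pa K)) 0) *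
          Real.exp (-(z ⬝ᵥ (Rᵀ * condPrecision G p * R) *ᵥ z) / 2) := fun z => by
      have h4 := congrFun h2 (z + m)
      simp only [Function.comp_apply] at h4
      rw [gaussianDensity_eq_mul_exp, add_sub_cancel_right, hquad] at h4
      have := gaussianDensity_pos 0 hp 0
      exact (ENNReal.ofReal_eq_ofReal_iff (by positivity) (by positivity)).1 h4
    -- At the mean the exponentials disappear and the normalizing constants are compared; cancelling
    -- them leaves the exponents.
    have h0 := h3 0
    simp only [zero_dotProduct, neg_zero, zero_div, Real.exp_zero, mul_one] at h0
    rw [← sub_eq_zero]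
    refine Matrix.eq_zero_of_dotProduct_mulVec_self ?_ fun z => ?_
    · rw [transpose_sub, transpose_nonsing_inv, covMat_transpose, transpose_mul, transpose_mul,
        transpose_transpose, condPrecision_transpose hp hR, Matrix.mul_assoc]
    · have h5 := h3 z
      rw [h0] at h5
      have h6 := Real.exp_injective (mul_left_cancel₀ hc.ne' h5)
      rw [sub_mulVec, dotProduct_sub]
      linarith
  · intro h
    have hD := (covMat_inv_eq_iff hp hR).1 h
    refine (hleft.trans (.of_eq ?_)).trans hprod.symm
    ext x
    rw [gaussianDensity_eq_mul_exp, hquad, ← h, gaussianDensity_zero_eq_prod hp hR hD]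

end UCG

/-! ### The two implications -/

namespace UCG

open Matrix

variable {V : Type*} [Fintype V] {G : UCG V}

theorem StrictDescendant.not_symm {i j : V} (h : G.StrictDescendant (G.component i) j) :
    ¬ G.StrictDescendant (G.component j) i := by
  rintro ⟨l, hl, d, hd, hdi⟩
  obtain ⟨k, hk, c, hc, hcj⟩ := h
  have hjl := reflTransGen_of_reachable (mem_component.1 hl)
  have hik := reflTransGen_of_reachable (mem_component.1 hk)
  refine G.no_semidirected_cycle k c hc (hcj.trans (hjl.trans (.head ?_ (hdi.trans hik))))
  exact hd.elim .inl fun h => .inr (.inl h)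

variable [DecidableEq V] {p : Measure (V → ℝ)}
  {R : Matrix V V ℝ}

theorem exists_residualMatrix (hp : (covMat p).PosDef) (G : UCG V) :
    ∃ R : Matrix V V ℝ, ∀ i, IsResidual (covMat p) (G.Pa (G.component i)) i (R i) := by
  choose R hR using fun i => exists_isResidual hp (not_mem_Pa_component (G := G) i)
  exact ⟨of R, hR⟩

section FactorizationToMarkov

/-- The father coefficients `F` themselves need not be sparse; `M F` is, because it is minus the
father columns of `M R`, whose rows are rows of `Ω`. This is why the flow system is written in terms
of `M`, `β` and `S = M F`. -/
theorem globalMarkov_of_factorizes [IsGaussian p] (hp : (covMat p).PosDef)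
    (hfact : Factorizes p G) (hmo : ZeroMothers p G) (hfa : ZeroFathers p G)
    (hne : ZeroNeighbours p G) : GlobalMarkov p G := by
  obtain ⟨R, hR⟩ := exists_residualMatrix hp G
  have hD := (factorizes_iff hp hR).1 hfact
  have hDM := mul_condPrecision hp hR (fun _ _ _ => rfl) hD
  set M := condPrecision G p with hMdef
  have hMpos : M.PosDef := by
    rw [← inv_eq_right_inv hDM]
    exact (posDef_mul_mul_transpose hR hp).inv
  let β : Matrix V V ℝ := of fun i j => if j ∈ G.Mo (G.component i) then -R i j else 0
  let F : Matrix V V ℝ := of fun i j => if j ∈ G.Fa (G.component i) then -R i j else 0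
  have hsplit : 1 - β - F = R := by
    ext i j
    simp only [Matrix.sub_apply, β, F, of_apply]
    have hi := not_mem_Pa_component (G := G) i
    rw [Pa, Finset.mem_union, not_or] at hi
    by_cases hij : i = j
    · subst hij
      simp [hi.1, hi.2, (hR i).apply_self]
    · rw [one_apply_ne hij]
      by_cases h1 : j ∈ G.Fa (G.component i)
      · simp [h1, not_mem_Mo_of_mem_Fa (component_mem_Cc i) h1]
      · by_cases h2 : j ∈ G.Mo (G.component i)
        · simp [h1, h2]
        · simp [h1, h2, (hR i).apply_eq_zero j (Ne.symm hij)
            (by rw [Pa, Finset.mem_union, not_or]; exact ⟨h1, h2⟩)]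
  have hTR : M * (1 - β) - M * F = M * R := by rw [← Matrix.mul_sub, hsplit]
  have hM : ∀ i j, M i j ≠ 0 → i = j ∨ G.und.Adj i j := by
    intro i j hij
    by_contra! h
    have hj : j ∈ G.component i := by
      by_contra hj
      exact hij (condPrecision_eq_zero hj)
    have hK := component_mem_Cc (G := G) i
    refine hij ?_
    rw [hMdef, condPrecision_apply hK ⟨i, self_mem_component i⟩ ⟨j, hj⟩]
    refine hne _ hK _ _ (fun h' => h.1 (congrArg Subtype.val h')) ?_
    rw [Finset.mem_sdiff, mem_Ne]
    refine ⟨hj, ?_⟩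
    rintro ⟨a, ha, h'⟩
    obtain rfl : a = i := Finset.mem_singleton.1 ha
    exact h.2 h'.symm
  have hβ : ∀ i j, β i j ≠ 0 → G.dashed j i := by
    intro i j hij
    by_contra h
    have hj : j ∈ G.Mo (G.component i) := by
      by_contra hj
      exact hij (if_neg hj)
    refine hij ((if_pos hj).trans ?_)
    rw [← (hR i).regCoef_eq hp ⟨i, self_mem_component i⟩ ⟨j, Finset.mem_union_right _ hj⟩
      (not_mem_Pa_component i)]
    refine hmo _ (component_mem_Cc i) _ _ ?_
    rw [Finset.mem_sdiff, mem_Mo (X := {_})]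
    refine ⟨hj, ?_⟩
    rintro ⟨a, ha, h'⟩
    obtain rfl : a = i := Finset.mem_singleton.1 ha
    exact h h'
  have hS : ∀ i j, (M * F) i j ≠ 0 → G.solid j i := by
    intro i j hij
    by_contra h
    have hsum : (M * F) i j = ∑ k ∈ G.component i, M i k * F k j := by
      rw [mul_apply]
      refine (Finset.sum_subset (Finset.subset_univ _) fun k _ hk => ?_).symm
      rw [hMdef, condPrecision_eq_zero hk, zero_mul]
    have hK := component_mem_Cc (G := G) i
    by_cases hj : j ∈ G.Fa (G.component i)
    · refine hij ?_
      have h1 : (M * F) i j = -(M * R) i j := by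
        rw [mul_apply, mul_apply, ← Finset.sum_neg_distrib]
        refine Finset.sum_congr rfl fun k _ => ?_
        by_cases hk : k ∈ G.component i
        · have : F k j = -R k j := if_pos (by rwa [component_eq_of_mem hk])
          rw [this, mul_neg]
        · rw [hMdef, condPrecision_eq_zero hk, zero_mul, zero_mul, neg_zero]
      rw [h1, ← margPrecision_apply hp hR hK rfl
        ⟨i, Finset.mem_union_left _ (self_mem_component i)⟩
        ⟨j, Finset.mem_union_right _ (Finset.mem_union_left _ hj)⟩ (self_mem_component i),
        hfa _ hK _ _ (self_mem_component i), neg_zero]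
      rw [Finset.mem_sdiff, mem_Fa (X := {_})]
      refine ⟨hj, ?_⟩
      rintro ⟨a, ha, h'⟩
      obtain rfl : a = i := Finset.mem_singleton.1 ha
      exact h h'
    · refine hij (hsum.trans (Finset.sum_eq_zero fun k hk => ?_))
      have : F k j = 0 := if_neg (by rwa [component_eq_of_mem hk])
      rw [this, mul_zero]
  -- The bracket is `M R`, and the factorization gives `R Σ Rᵀ M = 1`.
  have hT : (M * (1 - β) - M * F) * covMat p * (M * (1 - β) - M * F)ᵀ = M := by
    have hMt : Mᵀ = M := condPrecision_transpose hp hR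
    rw [hTR, transpose_mul, hMt]
    calc M * R * covMat p * (Rᵀ * M) = M * (R * covMat p * Rᵀ * M) := by
          simp only [Matrix.mul_assoc]
      _ = M := by rw [hDM, Matrix.mul_one]
  intro X Y Z _ hXZ _ hsep
  rw [condIndepCoords_iff hp hXZ]
  intro x hx y hy
  exact exists_isResidual_of_separated hp hMpos hT hM hβ hS hsep hx hy
    (Finset.disjoint_left.1 hXZ hx)

end FactorizationToMarkov

section MarkovToFactorization

theorem covMat_mulVec_eq_zero_of_globalMarkov [IsGaussian p] (hp : (covMat p).PosDef)
    (hR : ∀ i, IsResidual (covMat p) (G.Pa (G.component i)) i (R i)) (h : GlobalMarkov p G)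
    {i u : V} (hu : u ∉ G.component i) (hu' : ¬ G.StrictDescendant (G.component i) u) :
    (covMat p *ᵥ R i) u = 0 := by
  by_cases hP : u ∈ G.Pa (G.component i)
  · exact (hR i).mulVec_eq_zero u hP
  · have hK := component_mem_Cc (G := G) i
    have hsep : G.Separated (G.component i) {u} (G.Pa (G.component i)) :=
      separated_Pa hK fun y hy => by
        rw [Finset.mem_singleton] at hy
        exact hy ▸ ⟨hu, hu'⟩
    obtain ⟨a, ha, hau⟩ := (condIndepCoords_iff hp (disjoint_Pa hK)).1
      (h _ _ _ (Finset.disjoint_singleton_right.2 hu) (disjoint_Pa hK)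
        (Finset.disjoint_singleton_left.2 hP) hsep) i (self_mem_component i) u
      (Finset.mem_singleton_self u)
    rwa [← ha.eq hp (hR i)]

theorem factorizes_of_globalMarkov [IsGaussian p] (hp : (covMat p).PosDef)
    (hR : ∀ i, IsResidual (covMat p) (G.Pa (G.component i)) i (R i)) (h : GlobalMarkov p G) :
    Factorizes p G := by
  -- Expand the residual of `i` over `i` and its component's parents. None of these is in the
  -- component of `j` or a strict descendant of it, or else `i` would violate the hypotheses, so
  -- each is uncorrelated with the residual of `j`.
  have key : ∀ i j, j ∉ G.component i → ¬ G.StrictDescendant (G.component j) i →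
      (R * covMat p * Rᵀ) i j = 0 := by
    intro i j hij hd
    have h1 : (R * covMat p * Rᵀ) i j = R i ⬝ᵥ covMat p *ᵥ R j := by
      rw [Matrix.mul_assoc]
      rfl
    rw [h1]
    refine Finset.sum_eq_zero fun v _ => ?_
    by_cases hv : v = i ∨ v ∈ G.Pa (G.component i)
    · rw [covMat_mulVec_eq_zero_of_globalMarkov hp hR h, mul_zero]
      · rcases hv with rfl | hv
        · exact fun h => hij (mem_component_comm.1 h)
        · intro hvj
          obtain ⟨c, hc, hvc⟩ := mem_Pa.1 hv
          exact hd ⟨v, hvj, c, hvc, reflTransGen_of_reachable (mem_component.1 hc).symm⟩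
      · rcases hv with rfl | hv
        · exact hd
        · rintro ⟨k, hk, d, hkd, hdv⟩
          obtain ⟨c, hc, hvc⟩ := mem_Pa.1 hv
          exact hd ⟨k, hk, d, hkd, (hdv.tail (hvc.elim .inl fun h => .inr (.inl h))).trans
            (reflTransGen_of_reachable (mem_component.1 hc).symm)⟩
    · rw [not_or] at hv
      rw [(hR i).apply_eq_zero v hv.1 hv.2, zero_mul]
  rw [factorizes_iff hp hR]
  intro i j hij
  -- Two nodes cannot each be a strict descendant of the other's component, so by symmetry of `R Σ
  -- Rᵀ` the pair may be swapped.
  by_cases hd : G.StrictDescendant (G.component j) i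
  · rw [← transpose_apply (R * covMat p * Rᵀ), transpose_mul, transpose_mul,
      transpose_transpose, covMat_transpose, ← Matrix.mul_assoc]
    exact key j i (fun h => hij (mem_component_comm.1 h)) hd.not_symm
  · exact key i j hij hd

/-- The residual of `i` on the parents other than `j` is uncorrelated with `j`. It is therefore also
the residual on all parents, with coefficient zero at `j`. -/
theorem zeroMothers_of_globalMarkov [IsGaussian p] (hp : (covMat p).PosDef)
    (h : GlobalMarkov p G) : ZeroMothers p G := by
  rintro K hK ⟨i, hi⟩ ⟨j, hjP⟩ hj
  rw [Finset.mem_sdiff] at hj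
  have hiP : i ∉ G.Pa K := Finset.disjoint_left.1 (disjoint_Pa hK) hi
  have hij : i ≠ j := fun h => hiP (h ▸ hjP)
  have hdisj : Disjoint {i} (G.Pa K \ {j}) :=
    Finset.disjoint_singleton_left.2 fun h => hiP (Finset.mem_sdiff.1 h).1
  obtain ⟨a, ha, haj⟩ := (condIndepCoords_iff hp hdisj).1
    (h {i} {j} _ (by simpa using hij) hdisj (by simp) (separated_mother hK hi hj.1 hj.2))
    i (Finset.mem_singleton_self i) j (Finset.mem_singleton_self j)
  have ha' : IsResidual (covMat p) (G.Pa K) i a :=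
    { apply_self := ha.apply_self
      apply_eq_zero := fun v h1 h2 => ha.apply_eq_zero v h1 fun h => h2 (Finset.mem_sdiff.1 h).1
      mulVec_eq_zero := fun z hz => by
        by_cases hzj : z = j
        · rw [hzj, haj]
        · exact ha.mulVec_eq_zero z (by simp [hz, hzj]) }
  rw [ha'.regCoef_eq hp ⟨i, hi⟩ ⟨j, hjP⟩ hiP, ha.apply_eq_zero j hij.symm (by simp), neg_zero]

/-- On `A`, the vector `Σ a` is a multiple of the unit vector at `i`, so `a` is that multiple of row
`i` of the precision matrix. The multiple is nonzero since `a i = 1`, and `a j = 0`. -/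
theorem _root_.IsResidual.margPrecision_eq_zero (hp : (covMat p).PosDef) {A : Finset V} {i j : A}
    (hij : i ≠ j) {a : V → ℝ} (ha : IsResidual (covMat p) (A \ {(i : V), (j : V)}) i a)
    (hj : (covMat p *ᵥ a) j = 0) : margPrecision p A i j = 0 := by
  have hu : IsUnit (covBlock p A A).det :=
    (hp.submatrix Subtype.val_injective : (covBlock p A A).PosDef).det_pos.ne'.isUnit
  have hsupp : ∀ v ∉ A, a v = 0 := fun v hv =>
    ha.apply_eq_zero v (fun h => hv (h ▸ i.2)) fun h => hv (Finset.mem_sdiff.1 h).1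
  have haj : a j = 0 :=
    ha.apply_eq_zero j (fun h => hij (Subtype.ext h.symm)) (by simp)
  have hvec : (fun v : A => a v) ᵥ* covBlock p A A = (covMat p *ᵥ a) i • Pi.single i 1 := by
    ext v
    have h1 : ((fun v : A => a v) ᵥ* covBlock p A A) v = (covMat p *ᵥ a) v := by
      conv_rhs => rw [← covMat_transpose p, mulVec_transpose]
      refine Eq.trans (Finset.sum_coe_sort A fun u => a u * covMat p u v)
        (Finset.sum_subset (Finset.subset_univ A) fun u _ hu => ?_)
      rw [hsupp u hu, zero_mul]
    rw [h1]
    by_cases hvi : v = i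
    · simp [hvi]
    · rw [Pi.smul_apply, Pi.single_eq_of_ne hvi, smul_zero]
      by_cases hvj : v = j
      · rw [hvj, hj]
      · refine ha.mulVec_eq_zero v ?_
        simp only [Finset.mem_sdiff, v.2, Finset.mem_insert, Finset.mem_singleton, true_and, not_or]
        exact ⟨fun h => hvi (Subtype.ext h), fun h => hvj (Subtype.ext h)⟩
  have h2 := congrArg (fun w => w ᵥ* margPrecision p A) hvec
  simp only [margPrecision, vecMul_vecMul, mul_nonsing_inv _ hu, vecMul_one, smul_vecMul,
    single_one_vecMul] at h2
  have hi1 := congrFun h2 i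
  have hj1 := congrFun h2 j
  simp only [Pi.smul_apply, smul_eq_mul, ha.apply_self, haj] at hi1 hj1
  refine (mul_eq_zero.1 hj1.symm).resolve_left fun h0 => ?_
  rw [h0, zero_mul] at hi1
  exact one_ne_zero hi1

theorem margPrecision_eq_zero_of_globalMarkov [IsGaussian p] (hp : (covMat p).PosDef)
    (h : GlobalMarkov p G) {K : Finset V} (hK : K ∈ G.Cc) {i j : (K ∪ G.Pa K : Finset V)}
    (hi : (i : V) ∈ K) (hij : i ≠ j) (hu : ¬ G.und.Adj i j) (hs : ¬ G.solid j i)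
    (hd : (j : V) ∉ G.Mo K) : margPrecision p (K ∪ G.Pa K) i j = 0 := by
  have hij' : (i : V) ≠ j := fun h => hij (Subtype.ext h)
  have hdisj : Disjoint {(i : V)} ((K ∪ G.Pa K) \ {(i : V), (j : V)}) := by simp
  obtain ⟨a, ha, haj⟩ := (condIndepCoords_iff hp hdisj).1
    (h {(i : V)} {(j : V)} _ (by simpa using hij') hdisj (by simp)
      (separated_nonadjacent hK hi j.2 hij' hu hs hd))
    i (Finset.mem_singleton_self _) j (Finset.mem_singleton_self _)
  exact ha.margPrecision_eq_zero hp hij haj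

theorem zeroFathers_of_globalMarkov [IsGaussian p] (hp : (covMat p).PosDef)
    (h : GlobalMarkov p G) : ZeroFathers p G := by
  intro K hK i j hi hj
  rw [Finset.mem_sdiff, mem_Fa (X := {_})] at hj
  have hjK : (j : V) ∉ K := fun h =>
    Finset.disjoint_left.1 (disjoint_Pa hK) h (Finset.mem_union_left _ hj.1)
  exact margPrecision_eq_zero_of_globalMarkov hp h hK hi (fun h => hjK (h ▸ hi))
    (fun h => hjK (mem_of_und hK hi h)) (fun h => hj.2 ⟨i, Finset.mem_singleton_self _, h⟩)
    (not_mem_Mo_of_mem_Fa hK hj.1)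

/-- Within a component `R` is the identity, so `Ω` and the inverse of the conditional covariance
have the same `K × K` block. -/
theorem zeroNeighbours_of_globalMarkov [IsGaussian p] (hp : (covMat p).PosDef)
    (hR : ∀ i, IsResidual (covMat p) (G.Pa (G.component i)) i (R i)) (h : GlobalMarkov p G) :
    ZeroNeighbours p G := by
  rintro K hK ⟨i, hi⟩ ⟨j, hjK⟩ hij hj
  rw [Finset.mem_sdiff, mem_Ne] at hj
  have hjP : j ∉ G.Pa K := Finset.disjoint_left.1 (disjoint_Pa hK) hjK
  have hij' : i ≠ j := fun h => hij (Subtype.ext h)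
  have h1 := margPrecision_eq_zero_of_globalMarkov hp h hK
    (i := ⟨i, Finset.mem_union_left _ hi⟩) (j := ⟨j, Finset.mem_union_left _ hjK⟩) hi
    (fun h => hij' (congrArg Subtype.val h))
    (fun h => hj.2 ⟨i, Finset.mem_singleton_self _, h.symm⟩)
    (fun h => not_strictDescendant_of_mem hK hi (strictDescendant_of_arrow hjK (.inl h)))
    (fun h => hjP (Finset.mem_union_right _ h))
  rw [margPrecision_apply hp hR hK rfl _ _ hi, mul_apply, Finset.sum_eq_single j,
    (hR j).apply_self, mul_one] at h1
  · rwa [← condPrecision_apply hK]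
  · intro k _ hk
    by_cases hkK : k ∈ K
    · rw [(hR k).apply_eq_zero j hk.symm (by rwa [component_eq hK hkK]), mul_zero]
    · rw [condPrecision_eq_zero (by rwa [component_eq hK hi]), zero_mul]
  · simp

end MarkovToFactorization

end UCG

theorem mainTheorem2 {V : Type*} [Fintype V] [DecidableEq V] (G : UCG V)
    (p : Measure (V → ℝ)) [IsGaussian p] (hp : (covMat p).PosDef) :
    (Factorizes p G ∧ ZeroMothers p G ∧ ZeroFathers p G ∧ ZeroNeighbours p G) ↔
      GlobalMarkov p G := by
  obtain ⟨R, hR⟩ := UCG.exists_residualMatrix hp G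
  exact ⟨fun ⟨h1, h2, h3, h4⟩ => UCG.globalMarkov_of_factorizes hp h1 h2 h3 h4, fun h =>
    ⟨UCG.factorizes_of_globalMarkov hp hR h, UCG.zeroMothers_of_globalMarkov hp h,
      UCG.zeroFathers_of_globalMarkov hp h, UCG.zeroNeighbours_of_globalMarkov hp hR h⟩⟩
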